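/- Let $X$ be a standard Borel space with an atomless probability measure $\mu$, and let $R$ be a measured equivalence relation on $(X,\mu)$: its graph is Borel in $X\times X$, its classes are countable, and the saturation of every $\mu$-null Borel set is $\mu$-null. For Borel $K\subset R$ put $\mathfrak h(K)=\int_X \#\{y:(x,y)\in K\}\,d\mu(x)$. A unitary representation $\pi$ of $R$ on a measurable field $H=(H_x)_{x\in X}$ of separable complex Hilbert spaces is a family of unitaries $\pi(x,y):H_y\to H_x$, $(x,y)\in R$, with $\pi(x,x)=\mathrm{Id}$, $\pi(x,z)=\pi(x,y)\pi(y,z)$ for $x\sim y\sim z$, and with $(x,y)\mapsto\langle\pi(x,y)\xi_y|\eta_x\rangle$ measurable for all measurable sections $\xi,\eta$ of $H$ (called fields). A field $\xi$ is invariant if $\pi(x,y)\xi_y=\xi_x$ for $\mathfrak h$-almost every $(x,y)\in R$, and non-trivial if $\mu\{\xi_x\neq0\}>0$. A sequence of fields $\xi^n$ is almost invariant if there are Borel sets $K_n\subset R$, increasing, with $\mathfrak h(R\setminus\bigcup_nK_n)=0$, and $\varepsilon_n>0$ with $\varepsilon_n\to0$, such that for every $n$ one has $\|\pi(x,y)\xi^n_y-\xi^n_x\|\le\varepsilon_n$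 for $\mathfrak h$-almost every $(x,y)\in K_n$. Consider the following conditions on $\pi$. (i) (Zimmer) For every countable group $\Gamma$ and every action of $\Gamma$ on $X$ by Borel automorphisms whose orbit equivalence relation is $R$, every $\varepsilon>0$ and every finite $F\subset\Gamma$, there is $\xi\in L^\infty(X,H)$ with $\|\xi\|_\infty=1$ and $\mu\{x: |\langle\pi(x,\gamma x)\xi_{\gamma x}|\xi_x\rangle-1|\ge\varepsilon\}\le\varepsilon$ for all $\gamma\in F$. (ii) (Moore) There is an almost invariant sequence $\xi^n$ with $\|\xi^n_x\|=1$ for almost every $x$ and all $n$. (iii) ($L^\infty$) There are an almost invariant sequence $\xi^n\in L^\infty(X,H)$ and constants $\eta\ge1$, $\delta>0$ with $\mu\{1/\eta\le\|\xi^n_x\|\le\eta\}\ge\delta$ for all $n$. (iv)$_p$ (dominated $L^p$, $1\le p<\infty$) There are an almost invariant sequence $\xi^n\in L^p(X,H)$ with $\|\xi^n\|_p=1$ for all $n$ and a function $0\le g\in L^p(X)$ with $\|\xi^n_x\|\le g(x)$ for almost every $x$ and all $n$. The relation $R$ has Kazhdan's property T if every unitary representation of $R$ satisfying (ii) has an invariant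 field $\xi$ with $\|\xi_x\|=1$ for almost every $x$. **Theorem.** (a) $R$ has property T if and only if every unitary representation of $R$ satisfying (iii) has a non-trivial invariant field. (b) For every $1\le p<\infty$, $R$ has property T if and only if every unitary representation of $R$ satisfying (iv)$_p$ has a non-trivial invariant field. (c) If $R$ is ergodic (every Borel set that is a union of classes is null or conull), then for every unitary representation $\pi$ of $R$ and every $1\le p<\infty$, the conditions (i), (ii), (iii) and (iv)$_p$ are equivalent. -/

import Mathlib

open MeasureTheory Filter Topology
open scoped ENNReal

universe u v

section Relations

variable {X : Type u} [MeasurableSpace X]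

/-- The graph of an equivalence relation, as a subset of `X × X`. -/
def relGraph (R : Setoid X) : Set (X × X) := {p | R p.1 p.2}

/-- A measured equivalence relation: Borel graph, countable classes, and the saturation of every
Borel null set is a null set (quasi-invariance of `μ`). -/
structure IsMeasuredEquivRel (R : Setoid X) (μ : Measure X) : Prop where
  measurableSet_graph : MeasurableSet (relGraph R)
  countable_class : ∀ x, {y | R x y}.Countable
  quasiInvariant : ∀ A : Set X, MeasurableSet A → μ A = 0 → μ {x | ∃ y ∈ A, R x y} = 0

/-- Ergodicity: every Borel set that is a union of classes is null or conull. -/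
def IsErgodicRel (R : Setoid X) (μ : Measure X) : Prop :=
  ∀ A : Set X, MeasurableSet A → (∀ x y, R x y → (x ∈ A ↔ y ∈ A)) → μ A = 0 ∨ μ Aᶜ = 0

/-- The measure `𝔥` on the graph given by horizontal counting, `𝔥(K) = ∫ #(K ∩ R)ˣ dμ(x)`
where `Kˣ = {y | (x, y) ∈ K}`. It is only evaluated at Borel sets. -/
noncomputable def horizontalMeasure (R : Setoid X) (μ : Measure X) (K : Set (X × X)) : ℝ≥0∞ :=
  ∫⁻ x, Measure.count {y | R x y ∧ (x, y) ∈ K} ∂μ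

end Relations

/-- A measurable field of separable complex Hilbert spaces over `X`: a family of Hilbert spaces
together with a vector space of sections (the measurable ones) whose norms are measurable, which
contains every section having measurable scalar products with all of its members, and which
contains a sequence that is total in every fibre. -/
structure HilbertField (X : Type u) [MeasurableSpace X] where
  Fiber : X → Type v
  [normed : ∀ x, NormedAddCommGroup (Fiber x)]
  [innerProd : ∀ x, InnerProductSpace ℂ (Fiber x)]
  [complete : ∀ x, CompleteSpace (Fiber x)]
  measurableSections : Submodule ℂ (∀ x, Fiber x)
  measurable_norm : ∀ ξ ∈ measurableSections, Measurable fun x => ‖ξ x‖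
  mem_of_measurable_inner : ∀ η : ∀ x, Fiber x,
    (∀ ξ ∈ measurableSections, Measurable fun x => inner ℂ (ξ x) (η x)) →
      η ∈ measurableSections
  exists_total : ∃ e : ℕ → ∀ x, Fiber x, (∀ n, e n ∈ measurableSections) ∧
    ∀ x, (Submodule.span ℂ (Set.range fun n => e n x)).topologicalClosure = ⊤

attribute [instance] HilbertField.normed HilbertField.innerProd HilbertField.complete

/-- A unitary representation of `R` on `H`: unitary operators `π(x, y) : H_y → H_x` for `x ∼ y`
satisfying the cocycle identities, with measurable coefficients on the graph of `R`. -/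
structure RelRepresentation {X : Type u} [MeasurableSpace X] (R : Setoid X)
    (H : HilbertField.{u, v} X) where
  op : ∀ x y, R x y → (H.Fiber y ≃ₗᵢ[ℂ] H.Fiber x)
  op_self : ∀ x (h : R x x) (v : H.Fiber x), op x x h v = v
  op_comp : ∀ x y z (hxy : R x y) (hyz : R y z) (hxz : R x z) (v : H.Fiber z),
    op x z hxz v = op x y hxy (op y z hyz v)
  measurable_coeff : ∀ ξ ∈ H.measurableSections, ∀ η ∈ H.measurableSections,
    Measurable fun p : {p : X × X // R p.1 p.2} =>
      inner ℂ (op p.1.1 p.1.2 p.2 (ξ p.1.2)) (η p.1.1)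

namespace RelRepresentation

variable {X : Type u} [MeasurableSpace X] {R : Setoid X} {H : HilbertField.{u, v} X}

/-- `ξ` is `(K, ε)`-invariant: `‖π(x, y) ξ_y - ξ_x‖ ≤ ε` for `𝔥`-almost every `(x, y) ∈ K`. -/
def IsApproxInvariant (π : RelRepresentation R H) (μ : Measure X) (K : Set (X × X)) (ε : ℝ)
    (ξ : ∀ x, H.Fiber x) : Prop :=
  horizontalMeasure R μ
    {p | p ∈ K ∧ ∃ h : R p.1 p.2, ε < ‖π.op p.1 p.2 h (ξ p.2) - ξ p.1‖} = 0

/-- An invariant field: a measurable section with `π(x, y) ξ_y = ξ_x` for `𝔥`-almost every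
`(x, y) ∈ R`. -/
def IsInvariantField (π : RelRepresentation R H) (μ : Measure X) (ξ : ∀ x, H.Fiber x) : Prop :=
  ξ ∈ H.measurableSections ∧
    horizontalMeasure R μ {p | ∃ h : R p.1 p.2, π.op p.1 p.2 h (ξ p.2) ≠ ξ p.1} = 0

/-- An almost invariant sequence: measurable sections `ξⁿ` that are `(Kₙ, εₙ)`-invariant, where
`εₙ → 0` and `(Kₙ)` is an increasing sequence of Borel subsets of `R` that exhausts `R` up to an
`𝔥`-null set. -/
def IsAlmostInvariantSeq (π : RelRepresentation R H) (μ : Measure X)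
    (ξ : ℕ → ∀ x, H.Fiber x) : Prop :=
  (∀ n, ξ n ∈ H.measurableSections) ∧
  ∃ (K : ℕ → Set (X × X)) (ε : ℕ → ℝ),
    (∀ n, MeasurableSet (K n)) ∧ (∀ n, K n ⊆ relGraph R) ∧ Monotone K ∧
    horizontalMeasure R μ (relGraph R \ ⋃ n, K n) = 0 ∧
    (∀ n, 0 < ε n) ∧ Tendsto ε atTop (𝓝 0) ∧
    ∀ n, π.IsApproxInvariant μ (K n) (ε n) (ξ n)

/-- Zimmer's condition. `Γ` runs over all countable groups acting on `X` by Borel automorphisms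
with orbit equivalence relation `R`; the hypothesis `h` in the set below holds for every `x`. -/
def ZimmerCondition (π : RelRepresentation R H) (μ : Measure X) : Prop :=
  ∀ (Γ : Type) [Group Γ] [Countable Γ] [MulAction Γ X] [MeasurableConstSMul Γ X],
    (∀ x y, R x y ↔ ∃ γ : Γ, y = γ • x) →
    ∀ ε : ℝ, 0 < ε → ∀ F : Finset Γ, ∃ ξ ∈ H.measurableSections,
      eLpNorm (fun x => ‖ξ x‖) ∞ μ = 1 ∧
      ∀ γ ∈ F, μ {x | ∃ h : R x (γ • x),
        ε ≤ ‖inner ℂ (π.op x (γ • x) h (ξ (γ • x))) (ξ x) - 1‖} ≤ ENNReal.ofReal ε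

/-- Moore's condition: an almost invariant sequence of unit fields
(equivalently worded: `π` almost contains invariant fields). -/
def MooreCondition (π : RelRepresentation R H) (μ : Measure X) : Prop :=
  ∃ ξ : ℕ → ∀ x, H.Fiber x, π.IsAlmostInvariantSeq μ ξ ∧
    ∀ n, ∀ᵐ x ∂μ, ‖ξ n x‖ = 1

/-- An almost invariant sequence that is non-trivial in the `L^∞` sense. -/
def LinftyCondition (π : RelRepresentation R H) (μ : Measure X) : Prop :=
  ∃ ξ : ℕ → ∀ x, H.Fiber x, π.IsAlmostInvariantSeq μ ξ ∧
    (∀ n, MemLp (fun x => ‖ξ n x‖) ∞ μ) ∧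
    ∃ η δ : ℝ, 1 ≤ η ∧ 0 < δ ∧
      ∀ n, ENNReal.ofReal δ ≤ μ {x | 1 / η ≤ ‖ξ n x‖ ∧ ‖ξ n x‖ ≤ η}

/-- An almost invariant sequence that is non-trivial in the dominated `L^p` sense. -/
def LpCondition (π : RelRepresentation R H) (μ : Measure X) (p : ℝ≥0∞) : Prop :=
  ∃ ξ : ℕ → ∀ x, H.Fiber x, π.IsAlmostInvariantSeq μ ξ ∧
    (∀ n, MemLp (fun x => ‖ξ n x‖) p μ) ∧
    (∀ n, eLpNorm (fun x => ‖ξ n x‖) p μ = 1) ∧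
    ∃ g : X → ℝ, (∀ x, 0 ≤ g x) ∧ MemLp g p μ ∧ ∀ n, ∀ᵐ x ∂μ, ‖ξ n x‖ ≤ g x

/-- `π` has a non-trivial invariant field, i.e. one whose support is not negligible. -/
def HasNontrivialInvariantField (π : RelRepresentation R H) (μ : Measure X) : Prop :=
  ∃ ξ : ∀ x, H.Fiber x, π.IsInvariantField μ ξ ∧ μ {x | ξ x ≠ 0} ≠ 0

end RelRepresentation

/-- Kazhdan's property T: every unitary representation with an almost invariant sequence of unit
fields has an invariant unit field. -/
def HasPropertyT {X : Type u} [MeasurableSpace X] (R : Setoid X) (μ : Measure X) : Prop :=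
  ∀ (H : HilbertField.{u, v} X) (π : RelRepresentation R H), π.MooreCondition μ →
    ∃ ξ : ∀ x, H.Fiber x, π.IsInvariantField μ ξ ∧ ∀ᵐ x ∂μ, ‖ξ x‖ = 1

/-! All conditions are compared with two extremes. The weak one is an almost invariant sequence
whose norms are at least some `c > 0` on sets of measure bounded below. The strong one is an almost
invariant sequence of fields that are unit on an invariant set `A` of positive measure and vanish
off `A`.

The key lemma, `RelRepresentation.IsAlmostInvariantSeq.exists_unit_on_invariant`, passes from weak
to strong. Almost invariance makes the norms of `ξⁿ` nearly constant along classes. By pigeonhole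
there are thresholds that these norms rarely approach, so by Borel-Cantelli the superlevel sets are
eventually invariant: for each group element, almost every point and its translate agree on
membership for large `n`. Their limsup yields `A`. Choosing at each point the first superlevel set
of index at least `k` that contains it gives a choice on which `x` and `γ • x` agree for large `k`,
so the selected vectors, once normalized, are still almost invariant.

The conditions (iii), (iv) and (i) each imply the weak form; for (iv) domination prevents
concentration on small sets. The strong form gives back (iii) and, after rescaling, (iv). In the
ergodic case `A` is conull and the strong form is (ii). For property T, a unit sequence on `A` is
completed by the trivial representation on the complement. Conversely, an exhaustion argument
assembles partial unit invariant fields into one on a conull set.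

Statements modulo `𝔥` are handled through Feldman-Moore: `R` is the orbit relation of a countable
group, so they become one almost everywhere statement on `X` per group element. Feldman-Moore rests
on Lusin-Novikov, proved by a Cantor scheme. -/

/-! ### The Lusin-Novikov theorem. -/

section LusinNovikov

open Set

/-- A set which is a countable union of Borel sets on which `f` is injective. -/
def IsSigmaInjOn {Z X : Type*} [MeasurableSpace Z] (f : Z → X) (S : Set Z) : Prop :=
  ∃ T : ℕ → Set Z, (∀ n, MeasurableSet (T n) ∧ InjOn f (T n)) ∧ S = ⋃ n, T n

namespace IsSigmaInjOn

variable {Z X : Type*} [MeasurableSpace Z] {f : Z → X} {S S' : Set Z}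

theorem measurableSet (h : IsSigmaInjOn f S) : MeasurableSet S := by
  obtain ⟨T, hT, rfl⟩ := h
  exact MeasurableSet.iUnion fun n => (hT n).1

theorem of_injOn (hS : MeasurableSet S) (h : InjOn f S) : IsSigmaInjOn f S :=
  ⟨fun _ => S, fun _ => ⟨hS, h⟩, (iUnion_const S).symm⟩

theorem empty : IsSigmaInjOn f (∅ : Set Z) := of_injOn MeasurableSet.empty (injOn_empty f)

theorem iUnion {ι : Type*} [Countable ι] {S : ι → Set Z} (h : ∀ i, IsSigmaInjOn f (S i)) :
    IsSigmaInjOn f (⋃ i, S i) := by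
  rcases isEmpty_or_nonempty ι with hι | hι
  · simpa using empty
  choose T hT hS using h
  obtain ⟨e, he⟩ := exists_surjective_nat (ι × ℕ)
  refine ⟨fun n => T (e n).1 (e n).2, fun n => hT _ _, ?_⟩
  ext z
  simp only [mem_iUnion, hS]
  constructor
  · rintro ⟨i, n, h⟩
    obtain ⟨m, hm⟩ := he (i, n)
    exact ⟨m, by rwa [hm]⟩
  · rintro ⟨m, h⟩
    exact ⟨_, _, h⟩

theorem union (h : IsSigmaInjOn f S) (h' : IsSigmaInjOn f S') : IsSigmaInjOn f (S ∪ S') := by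
  rw [union_eq_iUnion]
  exact iUnion fun b => by cases b <;> assumption

end IsSigmaInjOn

/-- A family of subsets of `Z` is negligible for `f : Z → X` if there is a `σ`-injective Borel set
which contains, over each point of `X`, the fibre of one of its members. -/
def IsNegligibleFamily {Z X κ : Type*} [MeasurableSpace Z] (f : Z → X) (A : κ → Set Z) : Prop :=
  ∃ S, IsSigmaInjOn f S ∧ ∀ x, ∃ k, A k ∩ f ⁻¹' {x} ⊆ S

/-- A family of pairs of sets separates points. -/
def SeparatesPairs {Z : Type*} (𝓠 : Set (Set Z × Set Z)) : Prop :=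
  ∀ z z', z ≠ z' → ∃ P ∈ 𝓠, z ∈ P.1 ∧ z' ∈ P.2

variable {Z X : Type*} [MeasurableSpace Z] [TopologicalSpace Z] [PolishSpace Z] [BorelSpace Z]
  [MeasurableSpace X] [TopologicalSpace X] [PolishSpace X] [BorelSpace X] {f : Z → X}

/-- An analytic set on which `f` is injective is contained in a Borel set on which `f` is
injective. -/
theorem MeasureTheory.AnalyticSet.exists_measurableSet_injOn (hf : Continuous f)
    {𝓠 : Set (Set Z × Set Z)} (h𝓠 : 𝓠.Countable) (hsep : SeparatesPairs 𝓠)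
    (hm : ∀ P ∈ 𝓠, MeasurableSet P.1 ∧ MeasurableSet P.2 ∧ Disjoint P.1 P.2)
    {D : Set Z} (hD : AnalyticSet D) (hinj : InjOn f D) :
    ∃ G, MeasurableSet G ∧ D ⊆ G ∧ InjOn f G := by
  have hinter : ∀ U : Set Z, MeasurableSet U → AnalyticSet (D ∩ U) := fun U hU => by
    rw [inter_eq_iInter]
    exact AnalyticSet.iInter fun b => by cases b <;> [exact hU.analyticSet; exact hD]
  -- Injectivity on `D` makes the images of `D ∩ P.1` and `D ∩ P.2` disjoint analytic sets, so Lusin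
  -- separation applies. Points of `P.1` are then required to map into `B P`, points of `P.2`
  -- outside it.
  have key : ∀ P : 𝓠, ∃ B : Set X, MeasurableSet B ∧ f '' (D ∩ P.1.1) ⊆ B ∧
      Disjoint (f '' (D ∩ P.1.2)) B := by
    intro P
    obtain ⟨h1, h2, h3⟩ := hm P P.2
    obtain ⟨B, hB1, hB2, hB3⟩ := AnalyticSet.measurablySeparable
      ((hinter _ h1).image_of_continuous hf) ((hinter _ h2).image_of_continuous hf) (by
        rw [Set.disjoint_left]
        rintro _ ⟨z, hz, rfl⟩ ⟨z', hz', h⟩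
        have : z' = z := hinj hz'.1 hz.1 h
        subst this
        exact Set.disjoint_left.1 h3 hz.2 hz'.2)
    exact ⟨B, hB3, hB1, hB2⟩
  choose B hB hB1 hB2 using key
  have : Countable 𝓠 := h𝓠
  refine ⟨⋂ P : 𝓠, ((P.1.1)ᶜ ∪ f ⁻¹' (B P)) ∩ ((P.1.2)ᶜ ∪ (f ⁻¹' (B P))ᶜ), ?_, ?_, ?_⟩
  · refine MeasurableSet.iInter fun P => ?_
    obtain ⟨h1, h2, h3⟩ := hm P P.2
    exact (h1.compl.union (hf.measurable (hB P))).inter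
      (h2.compl.union (hf.measurable (hB P)).compl)
  · intro z hz
    refine mem_iInter.2 fun P => ⟨?_, ?_⟩
    · by_cases h : z ∈ P.1.1
      · exact Or.inr (hB1 P ⟨z, ⟨hz, h⟩, rfl⟩)
      · exact Or.inl h
    · by_cases h : z ∈ P.1.2
      · exact Or.inr (Set.disjoint_left.1 (hB2 P) ⟨z, ⟨hz, h⟩, rfl⟩)
      · exact Or.inl h
  · intro z hz z' hz' h
    by_contra hne
    obtain ⟨P, hP, h1, h2⟩ := hsep z z' hne
    have a := (mem_iInter.1 hz ⟨P, hP⟩).1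
    have b := (mem_iInter.1 hz' ⟨P, hP⟩).2
    simp only [mem_union, mem_compl_iff, mem_preimage] at a b
    rw [h] at a
    tauto

/-- If every separating pair failed, the union `S'` of the resulting σ-injective sets would leave a
remainder `D` on which `f` is injective. Enlarging `D` to a Borel set would then make the original
family negligible. -/
theorem exists_split_not_isNegligibleFamily (hf : Continuous f)
    {𝓠 : Set (Set Z × Set Z)} (h𝓠 : 𝓠.Countable) (hsep : SeparatesPairs 𝓠)
    (hm : ∀ P ∈ 𝓠, MeasurableSet P.1 ∧ MeasurableSet P.2 ∧ Disjoint P.1 P.2)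
    {κ : Type*} [Countable κ] {B : κ → Set Z} (hB : ∀ k, MeasurableSet (B k))
    (hneg : ¬ IsNegligibleFamily f B) {k₀ k₁ : κ} (hk : k₀ ≠ k₁) (hBk : B k₀ = B k₁) :
    ∃ P ∈ 𝓠, ∀ B' : κ → Set Z, B' k₀ = B k₀ ∩ P.1 → B' k₁ = B k₁ ∩ P.2 →
      (∀ k, k ≠ k₀ → k ≠ k₁ → B' k = B k) → ¬ IsNegligibleFamily f B' := by
  classical
  by_contra! hcon
  choose! B' h0 h1 h2 S hS hcov using hcon
  have : Countable 𝓠 := h𝓠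
  set S' : Set Z := ⋃ P : 𝓠, S P
  have hS' : IsSigmaInjOn f S' := IsSigmaInjOn.iUnion fun P => hS P P.2
  have hSS' : ∀ P ∈ 𝓠, S P ⊆ S' := fun P hP => subset_iUnion (fun P : 𝓠 => S P) ⟨P, hP⟩
  have : Nonempty κ := ⟨k₀⟩
  -- The points of the common member `B k₀ = B k₁` off `S'` whose fibre meets every other member off
  -- `S'`.
  set D : Set Z := ⋂ k, if k = k₀ ∨ k = k₁ then B k₀ \ S' else f ⁻¹' (f '' (B k \ S'))
  have hD : AnalyticSet D := by
    refine AnalyticSet.iInter fun k => ?_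
    split_ifs
    · exact ((hB _).diff hS'.measurableSet).analyticSet
    · exact ((((hB _).diff hS'.measurableSet).analyticSet).image_of_continuous hf).preimage hf
  have hD0 : ∀ z ∈ D, z ∈ B k₀ \ S' := fun z hz => by simpa using mem_iInter.1 hz k₀
  have hDk : ∀ z ∈ D, ∀ k, k ≠ k₀ → k ≠ k₁ → ∃ w ∈ B k \ S', f w = f z := by
    intro z hz k h h'
    simpa [h, h'] using mem_iInter.1 hz k
  have hinj : InjOn f D := by
    intro z hz z' hz' hzz
    by_contra hne
    -- Over `f z` the set `S P` must swallow one split member. The points `z`, `z'` and the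
    -- witnesses `w` rule out `k₀`, `k₁` and the other indices respectively.
    obtain ⟨P, hP, hz1, hz2⟩ := hsep z z' hne
    obtain ⟨k, hk'⟩ := hcov P hP (f z)
    by_cases hk0 : k = k₀
    · subst hk0
      rw [h0 P hP] at hk'
      exact (hD0 z hz).2 (hSS' P hP (hk' ⟨⟨(hD0 z hz).1, hz1⟩, rfl⟩))
    by_cases hk1 : k = k₁
    · subst hk1
      rw [h1 P hP, ← hBk] at hk'
      exact (hD0 z' hz').2 (hSS' P hP (hk' ⟨⟨(hD0 z' hz').1, hz2⟩, hzz.symm⟩))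
    · obtain ⟨w, hw, hwz⟩ := hDk z hz k hk0 hk1
      rw [h2 P hP k hk0 hk1] at hk'
      exact hw.2 (hSS' P hP (hk' ⟨hw.1, hwz⟩))
  obtain ⟨G, hG, hDG, hGinj⟩ := hD.exists_measurableSet_injOn hf h𝓠 hsep hm hinj
  refine hneg ⟨S' ∪ G, hS'.union (IsSigmaInjOn.of_injOn hG hGinj), fun x => ?_⟩
  by_cases hx : ∃ k, k ≠ k₀ ∧ k ≠ k₁ ∧ B k ∩ f ⁻¹' {x} ⊆ S'
  · obtain ⟨k, -, -, h⟩ := hx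
    exact ⟨k, h.trans subset_union_left⟩
  · refine ⟨k₀, fun z hz => ?_⟩
    by_cases hzS : z ∈ S'
    · exact Or.inl hzS
    refine Or.inr (hDG (mem_iInter.2 fun k => ?_))
    split_ifs with hkk
    · exact ⟨hz.1, hzS⟩
    · push Not at hkk hx
      obtain ⟨w, hw, hw'⟩ := not_subset.1 (hx k hkk.1 hkk.2)
      exact ⟨w, ⟨hw.1, hw'⟩, hw.2.trans hz.2.symm⟩

theorem exists_splitting_not_isNegligibleFamily (hf : Continuous f)
    {𝓠 : Set (Set Z × Set Z)} (h𝓠 : 𝓠.Countable) (hsep : SeparatesPairs 𝓠)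
    (hm : ∀ P ∈ 𝓠, MeasurableSet P.1 ∧ MeasurableSet P.2 ∧ Disjoint P.1 P.2)
    {ι : Type*} [Finite ι] {A : ι → Set Z} (hA : ∀ i, MeasurableSet (A i))
    (hneg : ¬ IsNegligibleFamily f A) :
    ∃ U : ι × Bool → Set Z, (∀ i, (U (i, false), U (i, true)) ∈ 𝓠) ∧
      ¬ IsNegligibleFamily f (fun j : ι × Bool => A j.1 ∩ U j) := by
  classical
  cases nonempty_fintype ι
  -- Every member is duplicated, then the pairs of copies are split one at a time. For indices
  -- outside `s` the sets `U` are the whole space, so both copies are still equal.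
  suffices H : ∀ s : Finset ι, ∃ U : ι × Bool → Set Z,
      (∀ i ∈ s, (U (i, false), U (i, true)) ∈ 𝓠) ∧ (∀ i ∉ s, ∀ b, U (i, b) = univ) ∧
      ¬ IsNegligibleFamily f (fun j : ι × Bool => A j.1 ∩ U j) by
    obtain ⟨U, h, -, h'⟩ := H Finset.univ
    exact ⟨U, fun i => h i (Finset.mem_univ i), h'⟩
  intro s
  induction s using Finset.induction_on with
  | empty =>
    refine ⟨fun _ => univ, by simp, by simp, ?_⟩
    rintro ⟨S, hS, h⟩
    refine hneg ⟨S, hS, fun x => ?_⟩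
    obtain ⟨k, hk⟩ := h x
    exact ⟨k.1, by simpa using hk⟩
  | insert i s his ih =>
    obtain ⟨U, hU1, hU2, hU3⟩ := ih
    have hUm : ∀ j, MeasurableSet (U j) := by
      rintro ⟨j, b⟩
      by_cases hj : j ∈ s
      · cases b
        · exact (hm _ (hU1 j hj)).1
        · exact (hm _ (hU1 j hj)).2.1
      · rw [hU2 j hj]; exact MeasurableSet.univ
    obtain ⟨P, hP, h⟩ := exists_split_not_isNegligibleFamily hf h𝓠 hsep hm
      (fun j : ι × Bool => (hA j.1).inter (hUm j)) hU3 (k₀ := (i, false)) (k₁ := (i, true))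
      (by simp) (by simp [hU2 i his])
    refine ⟨fun j => if j.1 = i then (if j.2 then P.2 else P.1) else U j, ?_, ?_, ?_⟩
    · intro j hj
      by_cases hji : j = i
      · simpa [hji] using hP
      · simpa [hji] using hU1 j ((Finset.mem_insert.1 hj).resolve_left hji)
    · intro j hj b
      rw [Finset.mem_insert, not_or] at hj
      simpa [hj.1] using hU2 j hj.2 b
    · refine h _ ?_ ?_ ?_
      · simp [hU2 i his]
      · simp [hU2 i his]
      · rintro ⟨j, b⟩ h1 h2
        have : j ≠ i := by rintro rfl; cases b <;> simp_all
        simp [this]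

/-- Pairs of disjoint closed balls centred in a dense sequence suffice: two distinct points are
separated once four radii are less than their distance. -/
theorem exists_separatesPairs {Z : Type*} [MetricSpace Z] [TopologicalSpace.SeparableSpace Z]
    {ε : ℝ} (hε : 0 < ε) :
    ∃ 𝓠 : Set (Set Z × Set Z), 𝓠.Countable ∧ SeparatesPairs 𝓠 ∧
      ∀ P ∈ 𝓠, (IsClosed P.1 ∧ IsClosed P.2) ∧ Disjoint P.1 P.2 ∧
        (∀ a ∈ P.1, ∀ b ∈ P.1, dist a b ≤ ε) ∧ ∀ a ∈ P.2, ∀ b ∈ P.2, dist a b ≤ ε := by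
  rcases isEmpty_or_nonempty Z with hZ | hZ
  · exact ⟨∅, countable_empty, fun z => hZ.elim z, by simp⟩
  let q : ℕ → Z := TopologicalSpace.denseSeq Z
  let F : ℕ × ℕ × ℕ → Set Z × Set Z := fun t =>
    (Metric.closedBall (q t.1) (ε / (2 * (t.2.2 + 1))),
      Metric.closedBall (q t.2.1) (ε / (2 * (t.2.2 + 1))))
  refine ⟨range F ∩ {P | Disjoint P.1 P.2}, (countable_range F).mono inter_subset_left, ?_, ?_⟩
  · intro z z' hne
    obtain ⟨n, hn⟩ := exists_nat_gt (4 * ε / (2 * dist z z'))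
    have hd : 0 < dist z z' := dist_pos.2 hne
    have hr : 0 < ε / (2 * ((n : ℝ) + 1)) := by positivity
    have hr4 : 4 * (ε / (2 * ((n : ℝ) + 1))) < dist z z' := by
      rw [div_lt_iff₀ (by positivity)] at hn
      rw [← mul_div_assoc, div_lt_iff₀ (by positivity)]
      nlinarith
    obtain ⟨i, hi⟩ := (TopologicalSpace.denseRange_denseSeq Z).exists_dist_lt z hr
    obtain ⟨j, hj⟩ := (TopologicalSpace.denseRange_denseSeq Z).exists_dist_lt z' hr
    refine ⟨F (i, j, n), ⟨⟨_, rfl⟩, ?_⟩, hi.le, hj.le⟩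
    refine Set.disjoint_left.2 fun w hw hw' => ?_
    have hw1 : dist w (q i) ≤ ε / (2 * ((n : ℝ) + 1)) := hw
    have hw2 : dist w (q j) ≤ ε / (2 * ((n : ℝ) + 1)) := hw'
    have t1 := dist_triangle z (q i) z'
    have t2 := dist_triangle (q i) w z'
    have t3 := dist_triangle w (q j) z'
    rw [dist_comm] at hw1
    rw [dist_comm] at hj
    linarith
  · rintro _ ⟨⟨t, rfl⟩, hdis⟩
    have hball : ∀ c : Z, ∀ a ∈ Metric.closedBall c (ε / (2 * ((t.2.2 : ℝ) + 1))),
        ∀ b ∈ Metric.closedBall c (ε / (2 * ((t.2.2 : ℝ) + 1))), dist a b ≤ ε := by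
      intro c a ha b hb
      have h1 : ε / (2 * ((t.2.2 : ℝ) + 1)) ≤ ε / 2 := by
        apply div_le_div_of_nonneg_left hε.le (by norm_num)
        have : (0 : ℝ) ≤ t.2.2 := by positivity
        linarith
      have := dist_triangle_right a b c
      rw [Metric.mem_closedBall] at ha hb
      linarith
    exact ⟨⟨Metric.isClosed_closedBall, Metric.isClosed_closedBall⟩, hdis, hball _, hball _⟩

/-- The `n`-th level of the binary tree. -/
def BinaryLevel : ℕ → Type
  | 0 => Unit
  | n + 1 => BinaryLevel n × Bool

instance BinaryLevel.finite : ∀ n, Finite (BinaryLevel n)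
  | 0 => inferInstanceAs (Finite Unit)
  | n + 1 =>
    have := BinaryLevel.finite n
    inferInstanceAs (Finite (BinaryLevel n × Bool))

/-- The vertex at level `n` of a branch of the binary tree. -/
def BinaryLevel.ofBranch (a : ℕ → Bool) : ∀ n, BinaryLevel n
  | 0 => ()
  | n + 1 => (BinaryLevel.ofBranch a n, a n)

theorem BinaryLevel.ofBranch_congr {a b : ℕ → Bool} {n : ℕ} (h : ∀ m < n, a m = b m) :
    ofBranch a n = ofBranch b n := by
  induction n with
  | zero => rfl
  | succ n ih =>
    exact Prod.ext (ih fun m hm => h m (hm.trans n.lt_succ_self)) (h n n.lt_succ_self)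

/-- A Cantor scheme of closed sets whose levels meet a common fibre produces an uncountable
fibre. -/
theorem exists_not_countable_fiber {Z X : Type*} [MetricSpace Z] [CompleteSpace Z]
    [TopologicalSpace X] [T2Space X] {f : Z → X} (hf : Continuous f)
    (C : ∀ n, BinaryLevel n → Set Z) (hC : ∀ n i, IsClosed (C n i))
    (hsub : ∀ n (i : BinaryLevel n) (b : Bool), C (n + 1) (i, b) ⊆ C n i)
    (hdisj : ∀ n (i : BinaryLevel n), Disjoint (C (n + 1) (i, false)) (C (n + 1) (i, true)))
    (hdist : ∀ n i, ∀ a ∈ C (n + 1) i, ∀ b ∈ C (n + 1) i, dist a b ≤ (1 / 2) ^ n)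
    (hfib : ∀ n, ∃ x, ∀ i, (C n i ∩ f ⁻¹' {x}).Nonempty) :
    ∃ x, ¬ (f ⁻¹' {x}).Countable := by
  choose x w hw using hfib
  have hpow : Tendsto (fun n : ℕ => ((1 : ℝ) / 2) ^ n) atTop (𝓝 0) :=
    tendsto_pow_atTop_nhds_zero_of_lt_one (by norm_num) (by norm_num)
  have hanti : ∀ a : ℕ → Bool, Antitone fun n => C n (BinaryLevel.ofBranch a n) :=
    fun a => antitone_nat_of_succ_le fun n => hsub n _ _
  have hlim : ∀ a : ℕ → Bool, ∃ z, ∀ n, z ∈ C n (BinaryLevel.ofBranch a n) := by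
    intro a
    have hcau : CauchySeq fun n => w (n + 1) (BinaryLevel.ofBranch a (n + 1)) := by
      refine cauchySeq_of_le_tendsto_0 (fun n => ((1 : ℝ) / 2) ^ n) (fun n m N hn hm => ?_) hpow
      exact hdist N (BinaryLevel.ofBranch a (N + 1)) _
        (hanti a (Nat.succ_le_succ hn) (hw _ _).1) _ (hanti a (Nat.succ_le_succ hm) (hw _ _).1)
    obtain ⟨z, hz⟩ := cauchySeq_tendsto_of_complete hcau
    refine ⟨z, fun n => (hC n _).mem_of_tendsto hz ?_⟩
    filter_upwards [eventually_ge_atTop n] with m hm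
    exact hanti a (hm.trans m.le_succ) (hw _ _).1
  choose z hz using hlim
  -- The base points `x n` do not depend on the branch, so all the limits `z a` lie in one fibre.
  have htend : ∀ a, Tendsto (fun n => x (n + 1)) atTop (𝓝 (f (z a))) := by
    intro a
    have h1 : Tendsto (fun n => w (n + 1) (BinaryLevel.ofBranch a (n + 1))) atTop (𝓝 (z a)) := by
      rw [tendsto_iff_dist_tendsto_zero]
      exact squeeze_zero (fun _ => dist_nonneg)
        (fun n => hdist n _ _ (hw _ _).1 _ (hz a (n + 1))) hpow
    exact ((hf.tendsto _).comp h1).congr fun n => (hw (n + 1) _).2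
  have hinj : Function.Injective z := by
    intro a b hab
    by_contra hne
    have hex : ∃ n, a n ≠ b n := Function.ne_iff.1 hne
    classical
    have hmin : ∀ m < Nat.find hex, a m = b m := fun m hm => not_not.1 (Nat.find_min hex hm)
    have hn := Nat.find_spec hex
    set n := Nat.find hex
    have ha : z a ∈ C (n + 1) (BinaryLevel.ofBranch a n, a n) := hz a (n + 1)
    have hb : z a ∈ C (n + 1) (BinaryLevel.ofBranch a n, b n) := by
      rw [BinaryLevel.ofBranch_congr hmin, hab]
      exact hz b (n + 1)
    have := Set.disjoint_left.1 (hdisj n (BinaryLevel.ofBranch a n))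
    cases h1 : a n <;> cases h2 : b n <;> simp_all
  refine ⟨f (z fun _ => true), fun hcount => ?_⟩
  have hr : (range z).Countable := hcount.mono (by
    rintro _ ⟨a, rfl⟩
    exact tendsto_nhds_unique (htend a) (htend _))
  have : Countable (ℕ → Bool) := by
    have := hr.to_subtype
    exact (Set.rangeFactorization_injective.2 hinj).countable
  obtain ⟨e, he⟩ := exists_surjective_nat (ℕ → Bool)
  obtain ⟨n, hn⟩ := he fun n => !(e n n)
  simpa using congrFun hn n

/-- **Lusin-Novikov theorem**: if a continuous map between Polish spaces has countable fibres, then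
its source is a countable union of Borel sets on which it is injective. -/
theorem isSigmaInjOn_univ_of_countable_fibers (hf : Continuous f)
    (hcount : ∀ x, (f ⁻¹' {x}).Countable) : IsSigmaInjOn f univ := by
  let _ := TopologicalSpace.upgradeIsCompletelyMetrizable Z
  by_contra hneg
  have hneg0 : ¬ IsNegligibleFamily f (fun _ : BinaryLevel 0 => (univ : Set Z)) := by
    rintro ⟨S, hS, h⟩
    have : S = univ := eq_univ_of_forall fun z => by
      obtain ⟨k, hk⟩ := h (f z)
      exact hk ⟨mem_univ z, rfl⟩
    exact hneg (this ▸ hS)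
  have step : ∀ n (A : BinaryLevel n → Set Z), (∀ i, IsClosed (A i)) → ¬ IsNegligibleFamily f A →
      ∃ A' : BinaryLevel (n + 1) → Set Z, (∀ i, IsClosed (A' i)) ∧ ¬ IsNegligibleFamily f A' ∧
        (∀ (i : BinaryLevel n) (b : Bool), A' (i, b) ⊆ A i) ∧
        (∀ i : BinaryLevel n, Disjoint (A' (i, false)) (A' (i, true))) ∧
        ∀ i, ∀ a ∈ A' i, ∀ b ∈ A' i, dist a b ≤ (1 / 2) ^ n := by
    intro n A hA hn
    obtain ⟨𝓠, h𝓠, hsep, hm⟩ := exists_separatesPairs (Z := Z)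
      (show (0 : ℝ) < (1 / 2) ^ n by positivity)
    obtain ⟨U, hU, hU'⟩ := exists_splitting_not_isNegligibleFamily hf h𝓠 hsep
      (fun P hP => ⟨(hm P hP).1.1.measurableSet, (hm P hP).1.2.measurableSet, (hm P hP).2.1⟩)
      (fun i => (hA i).measurableSet) hn
    refine ⟨fun j : BinaryLevel n × Bool => A j.1 ∩ U j, ?_, hU', fun i b => inter_subset_left,
      fun i => ?_, ?_⟩
    · rintro ⟨i, b⟩
      refine (hA i).inter ?_
      cases b
      · exact (hm _ (hU i)).1.1
      · exact (hm _ (hU i)).1.2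
    · exact (hm _ (hU i)).2.1.mono inter_subset_right inter_subset_right
    · rintro ⟨i, b⟩ a ha b' hb'
      cases b
      · exact (hm _ (hU i)).2.2.1 a ha.2 b' hb'.2
      · exact (hm _ (hU i)).2.2.2 a ha.2 b' hb'.2
  choose! A' h1 h2 h3 h4 h5 using step
  let C : ∀ n, BinaryLevel n → Set Z := fun n =>
    Nat.rec (motive := fun n => BinaryLevel n → Set Z) (fun _ => univ) A' n
  have hC : ∀ n, (∀ i, IsClosed (C n i)) ∧ ¬ IsNegligibleFamily f (C n) := by
    intro n
    induction n with
    | zero => exact ⟨fun _ => isClosed_univ, hneg0⟩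
    | succ n ih => exact ⟨h1 n _ ih.1 ih.2, h2 n _ ih.1 ih.2⟩
  obtain ⟨x, hx⟩ := exists_not_countable_fiber hf C (fun n => (hC n).1)
    (fun n => h3 n _ (hC n).1 (hC n).2) (fun n => h4 n _ (hC n).1 (hC n).2)
    -- Since the empty set is σ-injective, a non-negligible family has a point over which all of its
    -- members are nonempty.
    (fun n => h5 n _ (hC n).1 (hC n).2) (fun n => by
      by_contra! hcon
      exact (hC n).2 ⟨∅, IsSigmaInjOn.empty, fun x => by
        obtain ⟨i, hi⟩ := hcon x
        exact ⟨i, hi.subset⟩⟩)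
  exact hx (hcount x)

end LusinNovikov

/-! ### The Feldman-Moore theorem. -/

section FeldmanMoore

open Set

/-- A Borel map between standard Borel spaces with countable fibres is injective on the members of
a countable Borel cover of its source. -/
theorem Measurable.isSigmaInjOn_univ {Z X : Type*} [MeasurableSpace X] [StandardBorelSpace X]
    [MeasurableSpace Z] [StandardBorelSpace Z] {f : Z → X} (hf : Measurable f)
    (hcount : ∀ x, (f ⁻¹' {x}).Countable) : IsSigmaInjOn f univ := by
  let _ := upgradeStandardBorel X
  let tZ := upgradeStandardBorel Z
  have hZ := BorelSpace.measurable_eq (α := Z)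
  have hpolZ : PolishSpace Z := inferInstance
  -- A finer Polish topology makes `f` continuous and has the same Borel sets.
  obtain ⟨t', ht', hcont, hpol⟩ := hf.exists_continuous
  have hb : @BorelSpace Z t' _ :=
    @BorelSpace.mk _ t' _ (hZ.trans (borel_eq_borel_of_le hpol hpolZ ht').symm)
  exact @isSigmaInjOn_univ_of_countable_fibers Z X _ t' hpol hb _ _ _ _ _ hcont hcount

/-- A Borel subset of a product of standard Borel spaces with countable vertical sections is a
countable union of Borel graphs of partial functions. -/
theorem exists_iUnion_injOn_fst {X Y : Type*} [MeasurableSpace X] [StandardBorelSpace X]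
    [MeasurableSpace Y] [StandardBorelSpace Y] {E : Set (X × Y)} (hE : MeasurableSet E)
    (hcount : ∀ x, {y | (x, y) ∈ E}.Countable) :
    ∃ F : ℕ → Set (X × Y), (∀ n, MeasurableSet (F n) ∧ InjOn Prod.fst (F n)) ∧ E = ⋃ n, F n := by
  have : StandardBorelSpace E := hE.standardBorel
  have hm : Measurable fun p : E => p.1.1 := measurable_fst.comp measurable_subtype_coe
  obtain ⟨T, hT, hU⟩ := hm.isSigmaInjOn_univ
    (fun x => by
      have h1 : ((fun y => (x, y)) '' {y | (x, y) ∈ E}).Countable := (hcount x).image _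
      refine (h1.preimage_of_injOn Subtype.val_injective.injOn).mono ?_
      rintro ⟨⟨a, b⟩, hp⟩ hx
      obtain rfl : a = x := hx
      exact ⟨b, hp, rfl⟩)
  refine ⟨fun n => (↑) '' T n, fun n => ⟨hE.subtype_image (hT n).1, ?_⟩, ?_⟩
  · rintro _ ⟨p, hp, rfl⟩ _ ⟨q, hq, rfl⟩ h
    rw [(hT n).2 hp hq h]
  · rw [← image_iUnion, ← hU, image_univ, Subtype.range_coe]

variable {X : Type u} [MeasurableSpace X] [StandardBorelSpace X]

/-- A map of a standard Borel space whose graph is Borel is measurable. -/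
theorem measurable_of_measurableSet_graph {Y : Type*} [MeasurableSpace Y] [StandardBorelSpace Y]
    {f : X → Y} (hf : MeasurableSet {p : X × Y | p.2 = f p.1}) : Measurable f := by
  intro B hB
  have h : f ⁻¹' B = Prod.fst '' ({p : X × Y | p.2 = f p.1} ∩ Prod.snd ⁻¹' B) := by
    ext x
    constructor
    · intro hx
      exact ⟨(x, f x), ⟨rfl, hx⟩, rfl⟩
    · rintro ⟨⟨a, b⟩, ⟨h1, h2⟩, rfl⟩
      obtain rfl : b = f a := h1
      exact h2
  rw [h]
  refine (hf.inter (measurable_snd hB)).image_of_measurable_injOn measurable_fst ?_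
  rintro ⟨a, b⟩ ⟨h1, -⟩ ⟨a', b'⟩ ⟨h1', -⟩ hab
  obtain rfl : a = a' := hab
  obtain rfl : b = f a := h1
  obtain rfl : b' = f a := h1'
  rfl

/-- A Borel partial injection with disjoint domain and range extends to a Borel involution. -/
theorem exists_involution_of_partial_injection {G : Set (X × X)} (hG : MeasurableSet G)
    (h1 : InjOn Prod.fst G) (h2 : InjOn Prod.snd G)
    (hdisj : ∀ p ∈ G, ∀ q ∈ G, p.1 ≠ q.2) :
    ∃ σ : Equiv.Perm X, Measurable σ ∧ Measurable σ.symm ∧ (∀ p ∈ G, σ p.1 = p.2) ∧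
      ∀ x, σ x ≠ x → (x, σ x) ∈ G ∨ (σ x, x) ∈ G := by
  classical
  have u1 : ∀ {x y z}, (x, y) ∈ G → (x, z) ∈ G → y = z := fun ha hb =>
    congrArg Prod.snd (h1 ha hb rfl)
  have u2 : ∀ {x y z}, (y, x) ∈ G → (z, x) ∈ G → y = z := fun ha hb =>
    congrArg Prod.fst (h2 ha hb rfl)
  -- The involution exchanges the two ends of each pair in `G` and fixes every other point.
  have hex : ∀ x, ∃ y, (x, y) ∈ G ∨ (y, x) ∈ G ∨
      (y = x ∧ (∀ z, (x, z) ∉ G) ∧ ∀ z, (z, x) ∉ G) := by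
    intro x
    by_cases ha : ∃ y, (x, y) ∈ G
    · exact ha.imp fun y h => Or.inl h
    by_cases hb : ∃ y, (y, x) ∈ G
    · exact hb.imp fun y h => Or.inr (Or.inl h)
    push Not at ha hb
    exact ⟨x, Or.inr (Or.inr ⟨rfl, ha, hb⟩)⟩
  choose σ hσ using hex
  have hσ1 : ∀ x y, (x, y) ∈ G → σ x = y := by
    intro x y h
    rcases hσ x with h' | h' | h'
    · exact u1 h' h
    · exact absurd rfl (hdisj _ h _ h')
    · exact absurd h (h'.2.1 y)
  have hσ2 : ∀ x y, (y, x) ∈ G → σ x = y := by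
    intro x y h
    rcases hσ x with h' | h' | h'
    · exact absurd rfl (hdisj _ h' _ h)
    · exact u2 h' h
    · exact absurd h (h'.2.2 y)
  have hinv : Function.Involutive σ := by
    intro x
    rcases hσ x with h' | h' | h'
    · exact hσ2 _ _ h'
    · exact hσ1 _ _ h'
    · rw [h'.1, h'.1]
  have hD1 : MeasurableSet (Prod.fst '' G) := hG.image_of_measurable_injOn measurable_fst h1
  have hD2 : MeasurableSet (Prod.snd '' G) := hG.image_of_measurable_injOn measurable_snd h2
  have hgraph : {p : X × X | p.2 = σ p.1} = G ∪ Prod.swap ⁻¹' G ∪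
      ({p | p.2 = p.1} ∩ Prod.fst ⁻¹' (Prod.fst '' G ∪ Prod.snd '' G)ᶜ) := by
    ext ⟨x, y⟩
    constructor
    · intro (hy : y = σ x)
      subst hy
      rcases hσ x with h' | h' | h'
      · exact Or.inl (Or.inl h')
      · exact Or.inl (Or.inr h')
      · refine Or.inr ⟨h'.1, ?_⟩
        rintro (⟨⟨a, b⟩, h, rfl⟩ | ⟨⟨a, b⟩, h, rfl⟩)
        · exact h'.2.1 _ h
        · exact h'.2.2 _ h
    · rintro ((h | h) | ⟨h, h'⟩)
      · exact (hσ1 _ _ h).symm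
      · exact (hσ2 _ _ h).symm
      · obtain rfl : y = x := h
        rcases hσ y with h'' | h'' | h''
        · exact absurd (Or.inl ⟨_, h'', rfl⟩) h'
        · exact absurd (Or.inr ⟨_, h'', rfl⟩) h'
        · exact h''.1.symm
  have hmeas : Measurable σ := by
    apply measurable_of_measurableSet_graph
    rw [hgraph]
    refine (hG.union (measurable_swap hG)).union (MeasurableSet.inter ?_ ?_)
    · exact measurableSet_eq_fun measurable_snd measurable_fst
    · exact measurable_fst (hD1.union hD2).compl
  refine ⟨hinv.toPerm, hmeas, hmeas, fun p hp => hσ1 _ _ hp, fun x hx => ?_⟩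
  rcases hσ x with h' | h' | h'
  · exact Or.inl h'
  · exact Or.inr h'
  · exact absurd h'.1 hx

/-- **Feldman-Moore theorem**: a Borel equivalence relation with countable classes is the orbit
equivalence relation of a Borel action of a countable group. -/
theorem exists_mulAction_orbitRel_eq {R : Setoid X} (hR : MeasurableSet (relGraph R))
    (hcount : ∀ x, {y | R x y}.Countable) :
    ∃ _ : MulAction (FreeGroup ℕ) X, MeasurableConstSMul (FreeGroup ℕ) X ∧
      ∀ x y, R x y ↔ ∃ γ : FreeGroup ℕ, y = γ • x := by
  obtain ⟨F, hF, hRF⟩ := exists_iUnion_injOn_fst hR hcount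
  obtain ⟨W, hW, hWsep⟩ := exists_seq_separating X (p := MeasurableSet) MeasurableSet.empty univ
  let V : ℕ × Bool → Set X := fun k => if k.2 then W k.1 else (W k.1)ᶜ
  have hV : ∀ k, MeasurableSet (V k) := by
    rintro ⟨k, _ | _⟩ <;> simp [V, hW k]
  -- Intersecting one partial graph with the transpose of another gives a partial injection; the
  -- factor `V × Vᶜ` separates its domain from its range. Both a separating set and its complement
  -- occur among the `V`, so every off-diagonal pair of `R` lies in some `G t`.
  let G : ℕ × ℕ × ℕ × Bool → Set (X × X) := fun t =>
    F t.1 ∩ Prod.swap ⁻¹' F t.2.1 ∩ V t.2.2 ×ˢ (V t.2.2)ᶜ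
  have hG : ∀ t, ∃ σ : Equiv.Perm X, Measurable σ ∧ Measurable σ.symm ∧
      (∀ p ∈ G t, σ p.1 = p.2) ∧ ∀ x, σ x ≠ x → (x, σ x) ∈ G t ∨ (σ x, x) ∈ G t := by
    intro t
    refine exists_involution_of_partial_injection ?_ ?_ ?_ ?_
    · exact ((hF _).1.inter (measurable_swap (hF _).1)).inter
        ((hV _).prod (hV _).compl)
    · exact (hF t.1).2.mono fun p hp => hp.1.1
    · intro p hp q hq h
      exact Prod.swap_injective ((hF t.2.1).2 hp.1.2 hq.1.2 h)
    · rintro p ⟨-, hp⟩ q ⟨-, hq⟩ h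
      simp only [mem_prod, mem_compl_iff] at hp hq
      exact hq.2 (h ▸ hp.1)
  choose σ hσ1 hσ2 hσ3 hσ4 using hG
  obtain ⟨e, he⟩ := exists_surjective_nat (ℕ × ℕ × ℕ × Bool)
  let φ : FreeGroup ℕ →* Equiv.Perm X := FreeGroup.lift fun n => σ (e n)
  let act : MulAction (FreeGroup ℕ) X := MulAction.compHom X φ
  have hact : ∀ (γ : FreeGroup ℕ) (x : X), γ • x = φ γ x := fun _ _ => rfl
  have hGR : ∀ t p, p ∈ G t → R p.1 p.2 := fun t p hp => by
    have : p ∈ relGraph R := hRF ▸ mem_iUnion.2 ⟨_, hp.1.1⟩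
    exact this
  have hσR : ∀ t x, R x (σ t x) := by
    intro t x
    by_cases h : σ t x = x
    · rw [h]
    · rcases hσ4 t x h with h' | h'
      · exact hGR t _ h'
      · exact R.symm (hGR t _ h')
  refine ⟨act, ⟨fun γ => ?_⟩, fun x y => ⟨fun hxy => ?_, ?_⟩⟩
  · change Measurable (φ γ)
    induction γ using FreeGroup.induction_on with
    | C1 => simpa using measurable_id
    | of n => simpa [φ] using hσ1 (e n)
    | inv_of n _ => simpa [φ] using hσ2 (e n)
    | mul a b ha hb =>
      rw [map_mul]
      exact ha.comp hb
  · by_cases hne : x = y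
    · exact ⟨1, by rw [one_smul, hne]⟩
    obtain ⟨k, hk⟩ : ∃ k, x ∈ V k ∧ y ∉ V k := by
      by_contra! hcon
      refine hne (hWsep x (mem_univ x) y (mem_univ y) fun n => ?_)
      have h1 := hcon (n, true)
      have h2 := hcon (n, false)
      simp only [V, if_true, Bool.false_eq_true, if_false, mem_compl_iff] at h1 h2
      tauto
    obtain ⟨n, hn⟩ := mem_iUnion.1 (hRF ▸ (show (x, y) ∈ relGraph R from hxy))
    obtain ⟨m, hm⟩ := mem_iUnion.1 (hRF ▸ (show (y, x) ∈ relGraph R from R.symm hxy))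
    obtain ⟨i, hi⟩ := he (n, m, k)
    refine ⟨FreeGroup.of i, ?_⟩
    have : φ (FreeGroup.of i) x = y := by
      simp only [φ, FreeGroup.lift_apply_of, hi]
      exact hσ3 (n, m, k) (x, y) ⟨⟨hn, hm⟩, hk⟩
    rw [hact, this]
  · rintro ⟨γ, rfl⟩
    change R x (φ γ x)
    revert x
    induction γ using FreeGroup.induction_on with
    | C1 => intro x; simp
    | of n => intro x; simpa [φ] using hσR (e n) x
    | inv_of n _ =>
      intro x
      have := hσR (e n) ((σ (e n)).symm x)
      rw [Equiv.apply_symm_apply] at this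
      simpa [φ] using R.symm this
    | mul a b ha hb =>
      intro x
      rw [map_mul]
      exact R.trans (hb x) (ha _)

end FeldmanMoore

/-! ### Measurable sections and the invariance defect. -/

namespace HilbertField

variable {X : Type u} [MeasurableSpace X] (H : HilbertField.{u, v} X)

/-- Polarization reduces scalar products to norms, the only measurability assumed. -/
theorem measurable_inner {ξ η : ∀ x, H.Fiber x} (hξ : ξ ∈ H.measurableSections)
    (hη : η ∈ H.measurableSections) : Measurable fun x => inner ℂ (ξ x) (η x) := by
  have h : ∀ c : ℂ, Measurable fun x => ‖ξ x + c • η x‖ := fun c =>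
    H.measurable_norm (ξ + c • η) (add_mem hξ (Submodule.smul_mem _ c hη))
  have e : (fun x => inner ℂ (ξ x) (η x)) = fun x =>
      (((‖ξ x + (1 : ℂ) • η x‖ : ℂ)) ^ 2 - (‖ξ x + (-1 : ℂ) • η x‖ : ℂ) ^ 2 +
        ((‖ξ x + (-Complex.I) • η x‖ : ℂ) ^ 2 - (‖ξ x + Complex.I • η x‖ : ℂ) ^ 2)
          * Complex.I) / 4 := by
    funext x
    rw [inner_eq_sum_norm_sq_div_four (𝕜 := ℂ)]
    simp [sub_eq_add_neg]
  rw [e]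
  have := fun c => (Complex.measurable_ofReal.comp (h c)).pow_const 2
  exact ((((this 1).sub (this (-1))).add
    (((this (-Complex.I)).sub (this Complex.I)).mul_const _)).div_const _)

theorem smul_mem_measurableSections {c : X → ℂ} (hc : Measurable c) {ξ : ∀ x, H.Fiber x}
    (hξ : ξ ∈ H.measurableSections) : (fun x => c x • ξ x) ∈ H.measurableSections := by
  refine H.mem_of_measurable_inner _ fun η hη => ?_
  simp only [inner_smul_right]
  exact hc.mul (H.measurable_inner hη hξ)

theorem piecewise_mem_measurableSections {n : X → ℕ} (hn : Measurable n)
    {ξ : ℕ → ∀ x, H.Fiber x} (hξ : ∀ k, ξ k ∈ H.measurableSections) :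
    (fun x => ξ (n x) x) ∈ H.measurableSections := by
  refine H.mem_of_measurable_inner _ fun η hη => ?_
  have h : Measurable fun p : X × ℕ => inner ℂ (η p.1) (ξ p.2 p.1) :=
    measurable_from_prod_countable_left fun k => H.measurable_inner hη (hξ k)
  exact h.comp (measurable_id.prodMk hn)

theorem indicator_mem_measurableSections {A : Set X} [DecidablePred (· ∈ A)] (hA : MeasurableSet A) {ξ : ∀ x, H.Fiber x}
    (hξ : ξ ∈ H.measurableSections) :
    (fun x => if x ∈ A then ξ x else 0) ∈ H.measurableSections := by
  have h := H.smul_mem_measurableSections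
    (Measurable.ite hA measurable_const measurable_const : Measurable fun x =>
      if x ∈ A then (1 : ℂ) else 0) hξ
  convert h using 2 with x
  split_ifs <;> simp

end HilbertField

namespace RelRepresentation

variable {X : Type u} [MeasurableSpace X] {R : Setoid X} {H : HilbertField.{u, v} X}
  (π : RelRepresentation R H)

open Classical in
/-- The function `(x, y) ↦ ‖π(x, y) ξ_y - ξ_x‖` on `R`, extended by zero. -/
noncomputable def defect (ξ : ∀ x, H.Fiber x) (p : X × X) : ℝ :=
  if h : R p.1 p.2 then ‖π.op p.1 p.2 h (ξ p.2) - ξ p.1‖ else 0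

theorem defect_eq (ξ : ∀ x, H.Fiber x) {x y : X} (h : R x y) :
    π.defect ξ (x, y) = ‖π.op x y h (ξ y) - ξ x‖ := dif_pos h

theorem defect_nonneg (ξ : ∀ x, H.Fiber x) (p : X × X) : 0 ≤ π.defect ξ p := by
  unfold defect
  split_ifs
  · exact norm_nonneg _
  · exact le_rfl

theorem abs_norm_sub_norm_le_defect (ξ : ∀ x, H.Fiber x) {x y : X} (h : R x y) :
    |‖ξ y‖ - ‖ξ x‖| ≤ π.defect ξ (x, y) := by
  rw [π.defect_eq ξ h, ← (π.op x y h).norm_map (ξ y)]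
  exact abs_norm_sub_norm_le _ _

theorem norm_sq_defect (ξ : ∀ x, H.Fiber x) {x y : X} (h : R x y) :
    π.defect ξ (x, y) ^ 2 =
      ‖ξ y‖ ^ 2 + ‖ξ x‖ ^ 2 - 2 * (inner ℂ (π.op x y h (ξ y)) (ξ x)).re := by
  rw [π.defect_eq ξ h, @norm_sub_sq ℂ, (π.op x y h).norm_map]
  simp only [RCLike.re_to_complex]
  ring

theorem measurable_defect (hR : MeasurableSet (relGraph R)) {ξ : ∀ x, H.Fiber x}
    (hξ : ξ ∈ H.measurableSections) : Measurable (π.defect ξ) := by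
  classical
  have h1 : Measurable fun p : {p : X × X // R p.1 p.2} =>
      ‖π.op p.1.1 p.1.2 p.2 (ξ p.1.2) - ξ p.1.1‖ := by
    have hn := H.measurable_norm ξ hξ
    have e : (fun p : {p : X × X // R p.1 p.2} =>
        ‖π.op p.1.1 p.1.2 p.2 (ξ p.1.2) - ξ p.1.1‖) = fun p =>
        √(‖ξ p.1.2‖ ^ 2 + ‖ξ p.1.1‖ ^ 2 -
          2 * (inner ℂ (π.op p.1.1 p.1.2 p.2 (ξ p.1.2)) (ξ p.1.1)).re) := by
      funext p
      rw [← π.norm_sq_defect ξ p.2, Real.sqrt_sq (π.defect_nonneg _ _), π.defect_eq ξ p.2]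
    rw [e]
    have m1 : Measurable fun p : {p : X × X // R p.1 p.2} => ‖ξ p.1.2‖ :=
      hn.comp (measurable_snd.comp measurable_subtype_coe)
    have m2 : Measurable fun p : {p : X × X // R p.1 p.2} => ‖ξ p.1.1‖ :=
      hn.comp (measurable_fst.comp measurable_subtype_coe)
    have m3 := Complex.measurable_re.comp (π.measurable_coeff ξ hξ ξ hξ)
    exact (((m1.pow_const 2).add (m2.pow_const 2)).sub (m3.const_mul 2)).sqrt
  exact Measurable.dite h1 (measurable_const (α := ℝ)) hR

end RelRepresentation

/-- The exceptional set of the translated property lies in the saturation of a Borel null set. -/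
theorem IsMeasuredEquivRel.ae_smul {X : Type u} [MeasurableSpace X] {R : Setoid X} {μ : Measure X}
    {Γ : Type*} [Group Γ] [MulAction Γ X] (hR : IsMeasuredEquivRel R μ)
    (hΓ : ∀ x y, R x y ↔ ∃ γ : Γ, y = γ • x) (γ : Γ) {P : X → Prop} (h : ∀ᵐ x ∂μ, P x) :
    ∀ᵐ x ∂μ, P (γ • x) := by
  refine measure_mono_null (fun x hx => ?_) (hR.quasiInvariant (toMeasurable μ {x | ¬ P x})
    (measurableSet_toMeasurable _ _) (by rwa [measure_toMeasurable]))
  exact ⟨γ • x, subset_toMeasurable _ _ hx, (hΓ _ _).2 ⟨γ, rfl⟩⟩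

/-! ### From `𝔥`-null sets to almost everywhere statements for a countable group. -/

section Action

variable {X : Type u} [MeasurableSpace X] {R : Setoid X} {μ : Measure X}
  {Γ : Type*} [Group Γ] [Countable Γ] [MulAction Γ X] [MeasurableConstSMul Γ X]

/-- The relation is the countable union of the graphs of the group elements, and the measure of `K`
on each such graph is at most `𝔥(K)`. -/
theorem horizontalMeasure_eq_zero_iff (hΓ : ∀ x y, R x y ↔ ∃ γ : Γ, y = γ • x)
    {K : Set (X × X)} (hK : MeasurableSet K) :
    horizontalMeasure R μ K = 0 ↔ ∀ γ : Γ, ∀ᵐ x ∂μ, (x, γ • x) ∉ K := by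
  constructor
  · intro h γ
    have hE : MeasurableSet {x | (x, γ • x) ∈ K} :=
      (measurable_id.prodMk (measurable_const_smul γ)) hK
    have h1 : μ {x | (x, γ • x) ∈ K} ≤ horizontalMeasure R μ K := by
      rw [← lintegral_indicator_one hE]
      refine lintegral_mono fun x => ?_
      by_cases hx : x ∈ {x | (x, γ • x) ∈ K}
      · rw [Set.indicator_of_mem hx]
        exact (ENNReal.le_tsum (f := fun _ : {y | R x y ∧ (x, y) ∈ K} => (1 : ℝ≥0∞))
          ⟨γ • x, (hΓ _ _).2 ⟨γ, rfl⟩, hx⟩).trans Measure.le_count_apply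
      · rw [Set.indicator_of_notMem hx]
        exact zero_le
    rw [h] at h1
    simpa [ae_iff] using h1
  · intro h
    have h' : ∀ᵐ x ∂μ, ∀ γ : Γ, (x, γ • x) ∉ K := ae_all_iff.2 h
    have : ∀ᵐ x ∂μ, Measure.count {y | R x y ∧ (x, y) ∈ K} = 0 := by
      filter_upwards [h'] with x hx
      have : {y | R x y ∧ (x, y) ∈ K} = ∅ := by
        ext y
        simp only [Set.mem_ofPred_eq, Set.mem_empty_iff_false, iff_false, not_and]
        intro hy
        obtain ⟨γ, rfl⟩ := (hΓ _ _).1 hy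
        exact hx γ
      rw [this, measure_empty]
    unfold horizontalMeasure
    rw [lintegral_congr_ae this, lintegral_zero]

variable {H : HilbertField.{u, v} X} (π : RelRepresentation R H)

namespace RelRepresentation

theorem isApproxInvariant_iff (hR : MeasurableSet (relGraph R))
    (hΓ : ∀ x y, R x y ↔ ∃ γ : Γ, y = γ • x) {ξ : ∀ x, H.Fiber x}
    (hξ : ξ ∈ H.measurableSections) {K : Set (X × X)} (hK : MeasurableSet K)
    {ε : ℝ} (hε : 0 ≤ ε) :
    π.IsApproxInvariant μ K ε ξ ↔
      ∀ γ : Γ, ∀ᵐ x ∂μ, (x, γ • x) ∈ K → π.defect ξ (x, γ • x) ≤ ε := by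
  have e : {p : X × X | p ∈ K ∧ ∃ h : R p.1 p.2, ε < ‖π.op p.1 p.2 h (ξ p.2) - ξ p.1‖} =
      K ∩ {p | ε < π.defect ξ p} := by
    ext p
    refine and_congr_right fun _ => ?_
    by_cases h : R p.1 p.2
    · simp [defect, h]
    · simp [defect, h, hε]
  unfold IsApproxInvariant
  rw [e, horizontalMeasure_eq_zero_iff hΓ
    (hK.inter (measurableSet_lt measurable_const (π.measurable_defect hR hξ)))]
  simp only [Set.mem_inter_iff, Set.mem_ofPred_eq, not_and, not_lt]

theorem isInvariantField_iff (hR : MeasurableSet (relGraph R))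
    (hΓ : ∀ x y, R x y ↔ ∃ γ : Γ, y = γ • x) {ξ : ∀ x, H.Fiber x} :
    π.IsInvariantField μ ξ ↔ ξ ∈ H.measurableSections ∧
      ∀ γ : Γ, ∀ᵐ x ∂μ, π.defect ξ (x, γ • x) = 0 := by
  refine and_congr_right fun hξ => ?_
  have e : {p : X × X | ∃ h : R p.1 p.2, π.op p.1 p.2 h (ξ p.2) ≠ ξ p.1} =
      {p | π.defect ξ p = 0}ᶜ := by
    ext p
    by_cases h : R p.1 p.2
    · simp [defect, h, sub_eq_zero]
    · simp [defect, h]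
  rw [e, horizontalMeasure_eq_zero_iff hΓ
    (measurableSet_eq_fun (π.measurable_defect hR hξ) measurable_const).compl]
  simp only [Set.mem_compl_iff, Set.mem_ofPred_eq, not_not]

/-- This eliminates the exhausting sets: eventual estimates at almost every point carry the same
information as an exhaustion of `R`. -/
theorem isAlmostInvariantSeq_iff (hR : MeasurableSet (relGraph R))
    (hΓ : ∀ x y, R x y ↔ ∃ γ : Γ, y = γ • x) {ξ : ℕ → ∀ x, H.Fiber x} :
    π.IsAlmostInvariantSeq μ ξ ↔ (∀ n, ξ n ∈ H.measurableSections) ∧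
      ∃ ε : ℕ → ℝ, (∀ n, 0 < ε n) ∧ Tendsto ε atTop (𝓝 0) ∧
        ∀ γ : Γ, ∀ᵐ x ∂μ, ∀ᶠ n in atTop, π.defect (ξ n) (x, γ • x) ≤ ε n := by
  refine and_congr_right fun hξ => ?_
  constructor
  · rintro ⟨K, ε, hK, -, hmono, hex, hpos, hlim, hinv⟩
    refine ⟨ε, hpos, hlim, fun γ => ?_⟩
    have h1 := (horizontalMeasure_eq_zero_iff hΓ (hR.diff (MeasurableSet.iUnion hK))).1 hex γ
    have h2 := ae_all_iff.2 fun n =>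
      (π.isApproxInvariant_iff hR hΓ (hξ n) (hK n) (hpos n).le).1 (hinv n) γ
    filter_upwards [h1, h2] with x hx1 hx2
    have : (x, γ • x) ∈ ⋃ n, K n := by
      by_contra hcon
      exact hx1 ⟨(hΓ _ _).2 ⟨γ, rfl⟩, hcon⟩
    obtain ⟨m, hm⟩ := Set.mem_iUnion.1 this
    filter_upwards [eventually_ge_atTop m] with n hn
    exact hx2 n (hmono hn hm)
  · rintro ⟨ε, hpos, hlim, h⟩
    have hmeas : ∀ n, MeasurableSet (relGraph R ∩ ⋂ m ≥ n, {p | π.defect (ξ m) p ≤ ε m}) :=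
      fun n => hR.inter (MeasurableSet.biInter (Set.to_countable _) fun m _ =>
        measurableSet_le (π.measurable_defect hR (hξ m)) measurable_const)
    -- Taking the pairs where all estimates from index `n` on hold makes the sets increasing, and
    -- eventual validity makes them exhaust `R`.
    refine ⟨fun n => relGraph R ∩ ⋂ m ≥ n, {p | π.defect (ξ m) p ≤ ε m}, ε, hmeas,
      fun n => Set.inter_subset_left, ?_, ?_, hpos, hlim, ?_⟩
    · intro n n' hn p hp
      exact ⟨hp.1, Set.mem_iInter₂.2 fun m hm => Set.mem_iInter₂.1 hp.2 m (le_trans hn hm)⟩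
    · rw [horizontalMeasure_eq_zero_iff hΓ (hR.diff (MeasurableSet.iUnion hmeas))]
      intro γ
      filter_upwards [h γ] with x hx
      obtain ⟨m, hm⟩ := eventually_atTop.1 hx
      rintro ⟨hp, hp'⟩
      exact hp' (Set.mem_iUnion.2 ⟨m, hp, Set.mem_iInter₂.2 fun k hk => hm k hk⟩)
    · intro n
      rw [π.isApproxInvariant_iff hR hΓ (hξ n) (hmeas n) (hpos n).le]
      refine fun γ => Eventually.of_forall fun x hx => ?_
      exact Set.mem_iInter₂.1 hx.2 n le_rfl

end RelRepresentation

end Action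

/-! ### Thresholds and the key lemma. -/

/-- A measurable function on a probability space stays away from some threshold of a given interval
outside a small set. -/
theorem MeasureTheory.exists_measure_abs_sub_le_le {X : Type*} [MeasurableSpace X] {μ : Measure X}
    [IsProbabilityMeasure μ] {f : X → ℝ} (hf : Measurable f) {c ε : ℝ} (hε : 0 < ε) {M : ℕ}
    (hM : 0 < M) (hεM : 4 * M * ε < c) :
    ∃ t, c / 2 ≤ t ∧ t < c ∧ μ {x | |f x - t| ≤ ε} ≤ (M : ℝ≥0∞)⁻¹ := by
  have hM' : (0 : ℝ) < M := by exact_mod_cast hM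
  have hc : 0 < c := lt_trans (by positivity) hεM
  -- The spacing exceeds `2 * ε`, so the `M` bands around these levels are disjoint; their total
  -- mass is at most 1, hence one of them has mass at most `1 / M`.
  let t : ℕ → ℝ := fun j => c / 2 + j * (c / (2 * M))
  have hstep : 2 * ε < c / (2 * M) := by
    rw [lt_div_iff₀ (by positivity)]
    linarith
  by_contra! hcon
  have hlt : ∀ j ∈ Finset.range M, (M : ℝ≥0∞)⁻¹ < μ {x | |f x - t j| ≤ ε} := by
    intro j hj
    have hj' : (j : ℝ) < M := by exact_mod_cast Finset.mem_range.1 hj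
    refine hcon _ (le_add_of_nonneg_right (by positivity)) ?_
    have : (j : ℝ) * (c / (2 * M)) < M * (c / (2 * M)) :=
      mul_lt_mul_of_pos_right hj' (by positivity)
    have h2 : (M : ℝ) * (c / (2 * M)) = c / 2 := by field_simp
    simp only [t]
    linarith
  have hdisj : Set.PairwiseDisjoint (↑(Finset.range M)) fun j => {x | |f x - t j| ≤ ε} := by
    have key : ∀ i j : ℕ, i < j → ∀ x, |f x - t i| ≤ ε → |f x - t j| ≤ ε → False := by
      intro i j hij x h1 h2
      rw [abs_le] at h1 h2
      have h3 : (i : ℝ) + 1 ≤ j := by exact_mod_cast hij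
      have h4 : ((i : ℝ) + 1) * (c / (2 * M)) ≤ j * (c / (2 * M)) :=
        mul_le_mul_of_nonneg_right h3 (by positivity)
      simp only [t] at h1 h2
      linarith [h1.1, h1.2, h2.1, h2.2]
    intro i _ j _ hij
    refine Set.disjoint_left.2 fun x hx hx' => ?_
    rcases lt_or_gt_of_ne hij with h | h
    · exact key i j h x hx hx'
    · exact key j i h x hx' hx
  have hsum : ∑ j ∈ Finset.range M, μ {x | |f x - t j| ≤ ε} ≤ 1 := by
    rw [← measure_biUnion_finset hdisj fun j _ =>
      measurableSet_le (hf.sub measurable_const).abs measurable_const]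
    exact prob_le_one
  have hlt' := ENNReal.sum_lt_sum_of_nonempty ⟨0, Finset.mem_range.2 hM⟩ hlt
  rw [Finset.sum_const, Finset.card_range, nsmul_eq_mul,
    ENNReal.mul_inv_cancel (by exact_mod_cast hM.ne') (ENNReal.natCast_ne_top M)] at hlt'
  exact absurd hsum (not_le.2 hlt')

/-- Normalization is Lipschitz away from the origin, so it preserves almost invariance where the
norms are bounded below. -/
theorem norm_inv_norm_smul_sub_le {E : Type*} [NormedAddCommGroup E] [NormedSpace ℂ E] {r : ℝ}
    (hr : 0 < r) {u w : E} (hu : r ≤ ‖u‖) (hw : r ≤ ‖w‖) :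
    ‖((‖u‖⁻¹ : ℝ) : ℂ) • u - ((‖w‖⁻¹ : ℝ) : ℂ) • w‖ ≤ 2 * ‖u - w‖ / r := by
  have hu0 : 0 < ‖u‖ := hr.trans_le hu
  have hw0 : 0 < ‖w‖ := hr.trans_le hw
  have e : ((‖u‖⁻¹ : ℝ) : ℂ) • u - ((‖w‖⁻¹ : ℝ) : ℂ) • w =
      ((‖u‖⁻¹ : ℝ) : ℂ) • (u - w) + ((‖u‖⁻¹ - ‖w‖⁻¹ : ℝ) : ℂ) • w := by
    rw [Complex.ofReal_sub, sub_smul, smul_sub]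
    abel
  rw [e]
  refine (norm_add_le _ _).trans ?_
  rw [norm_smul, norm_smul, Complex.norm_real, Complex.norm_real, Real.norm_eq_abs,
    Real.norm_eq_abs, abs_of_pos (inv_pos.2 hu0)]
  have h1 : |‖u‖⁻¹ - ‖w‖⁻¹| * ‖w‖ = ‖u‖⁻¹ * |‖w‖ - ‖u‖| := by
    rw [inv_sub_inv hu0.ne' hw0.ne', abs_div, abs_of_pos (mul_pos hu0 hw0)]
    field_simp
  have h2 : |‖w‖ - ‖u‖| ≤ ‖u - w‖ := by
    rw [norm_sub_rev]
    exact abs_norm_sub_norm_le w u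
  have h3 : ‖u‖⁻¹ ≤ r⁻¹ := inv_anti₀ hr hu
  rw [h1]
  calc ‖u‖⁻¹ * ‖u - w‖ + ‖u‖⁻¹ * |‖w‖ - ‖u‖| ≤ r⁻¹ * ‖u - w‖ + r⁻¹ * ‖u - w‖ := by gcongr
    _ = 2 * ‖u - w‖ / r := by ring

section Action

variable {X : Type u} [MeasurableSpace X] {R : Setoid X} {μ : Measure X}
  {Γ : Type*} [Group Γ] [Countable Γ] [MulAction Γ X] [MeasurableConstSMul Γ X]

/-- An almost everywhere invariant Borel set contains an invariant Borel set of full measure. -/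
theorem exists_invariant_subset (hΓ : ∀ x y, R x y ↔ ∃ γ : Γ, y = γ • x) {A₀ : Set X}
    (hA₀ : MeasurableSet A₀) (h : ∀ γ : Γ, ∀ᵐ x ∂μ, x ∈ A₀ → γ • x ∈ A₀) :
    ∃ A ⊆ A₀, MeasurableSet A ∧ (∀ x y, R x y → (x ∈ A ↔ y ∈ A)) ∧ μ A = μ A₀ := by
  have hsub : {x | ∀ γ : Γ, γ • x ∈ A₀} ⊆ A₀ := fun x hx => by simpa using hx 1
  refine ⟨{x | ∀ γ : Γ, γ • x ∈ A₀}, hsub, ?_, ?_, ?_⟩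
  · simp only [Set.ofPred_forall]
    exact MeasurableSet.iInter fun γ => measurable_const_smul γ hA₀
  · intro x y hxy
    obtain ⟨γ, rfl⟩ := (hΓ x y).1 hxy
    constructor
    · intro hx γ'
      rw [smul_smul]
      exact hx _
    · intro hx γ'
      have := hx (γ' * γ⁻¹)
      rwa [smul_smul, inv_mul_cancel_right] at this
  · refine measure_congr ?_
    filter_upwards [ae_all_iff.2 h] with x hx
    exact propext ⟨fun hxA => hsub hxA, fun hxA γ => hx γ hxA⟩

variable {H : HilbertField.{u, v} X}

/-- If an almost invariant sequence does not vanish uniformly in measure, then there are an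
invariant Borel set of positive measure and an almost invariant sequence of unit fields on it. -/
theorem RelRepresentation.IsAlmostInvariantSeq.exists_unit_on_invariant [IsProbabilityMeasure μ]
    (hR : MeasurableSet (relGraph R)) (hΓ : ∀ x y, R x y ↔ ∃ γ : Γ, y = γ • x)
    {π : RelRepresentation R H} {ξ : ℕ → ∀ x, H.Fiber x} (hξ : π.IsAlmostInvariantSeq μ ξ)
    {c : ℝ} (hc : 0 < c) {δ : ℝ≥0∞} (hδ : δ ≠ 0) (hW : ∀ n, δ ≤ μ {x | c ≤ ‖ξ n x‖}) :
    ∃ A, MeasurableSet A ∧ (∀ x y, R x y → (x ∈ A ↔ y ∈ A)) ∧ μ A ≠ 0 ∧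
      ∃ ζ : ℕ → ∀ x, H.Fiber x, π.IsAlmostInvariantSeq μ ζ ∧
        (∀ n, ∀ x ∈ A, ‖ζ n x‖ = 1) ∧ ∀ n, ∀ x ∉ A, ζ n x = 0 := by
  classical
  rw [π.isAlmostInvariantSeq_iff hR hΓ] at hξ
  obtain ⟨hm₀, ε, -, hlim, hinv₀⟩ := hξ
  -- With `M = 2 ^ n` thresholds one has `4 * M * b n = c / 2 < c`, as the pigeonhole lemma
  -- requires. The bad bands then have summable measures `2 ^ (-n)`.
  let b : ℕ → ℝ := fun n => c / 8 * (1 / 2) ^ n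
  have hb : ∀ n, 0 < b n := fun n => by positivity
  have hbanti : Antitone b := fun m n hmn =>
    mul_le_mul_of_nonneg_left (pow_le_pow_of_le_one (by norm_num) (by norm_num) hmn)
      (by positivity)
  obtain ⟨φ, hφ, hφb⟩ := extraction_forall_of_eventually fun n =>
    (hlim.eventually (gt_mem_nhds (hb n)))
  have hm : ∀ n, ξ (φ n) ∈ H.measurableSections := fun n => hm₀ _
  have hinv : ∀ γ : Γ, ∀ᵐ x ∂μ, ∀ᶠ n in atTop, π.defect (ξ (φ n)) (x, γ • x) ≤ b n := by
    intro γ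
    filter_upwards [hinv₀ γ] with x hx
    filter_upwards [hφ.tendsto_atTop.eventually hx] with n hn
    exact hn.trans (hφb n).le
  have hf : ∀ n, Measurable fun x => ‖ξ (φ n) x‖ := fun n => H.measurable_norm _ (hm n)
  have hth : ∀ n, ∃ t, c / 2 ≤ t ∧ t < c ∧
      μ {x | |‖ξ (φ n) x‖ - t| ≤ b n} ≤ ((2 ^ n : ℕ) : ℝ≥0∞)⁻¹ := fun n =>
    exists_measure_abs_sub_le_le (hf n) (hb n) (by positivity) (by
      simp only [b]
      push_cast
      have : (2 : ℝ) ^ n * (1 / 2) ^ n = 1 := by rw [← mul_pow]; norm_num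
      nlinarith)
  choose t ht1 ht2 ht3 using hth
  have hE : ∀ᵐ x ∂μ, ∀ᶠ n in atTop, b n < |‖ξ (φ n) x‖ - t n| := by
    have hsum : ∑' n, μ {x | |‖ξ (φ n) x‖ - t n| ≤ b n} ≠ ∞ := by
      refine ne_top_of_le_ne_top ?_ (ENNReal.tsum_le_tsum ht3)
      have : ∀ n : ℕ, ((2 ^ n : ℕ) : ℝ≥0∞)⁻¹ = 2⁻¹ ^ n := fun n => by
        rw [Nat.cast_pow, Nat.cast_ofNat, ENNReal.inv_pow]
      simp only [this]
      rw [ENNReal.tsum_geometric]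
      simp
    filter_upwards [ae_eventually_notMem hsum] with x hx
    filter_upwards [hx] with n hn
    simpa using hn
  let B : ℕ → Set X := fun n => {x | t n < ‖ξ (φ n) x‖}
  have hBm : ∀ n, MeasurableSet (B n) := fun n => measurableSet_lt measurable_const (hf n)
  -- The norms at `x` and `γ • x` differ by at most `b n`, while the norm at `x` is further than
  -- that from `t n`; both therefore lie on the same side.
  have hBinv : ∀ γ : Γ, ∀ᵐ x ∂μ, ∀ᶠ n in atTop,
      π.defect (ξ (φ n)) (x, γ • x) ≤ b n ∧ (x ∈ B n ↔ γ • x ∈ B n) := by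
    intro γ
    filter_upwards [hinv γ, hE] with x h1 h2
    filter_upwards [h1, h2] with n hn1 hn2
    refine ⟨hn1, ?_⟩
    have h3 := (π.abs_norm_sub_norm_le_defect (ξ (φ n)) ((hΓ _ _).2 ⟨γ, rfl⟩)).trans hn1
    rw [abs_le] at h3
    change t n < _ ↔ t n < _
    rcases lt_abs.1 hn2 with h | h
    · exact ⟨fun _ => by linarith, fun _ => by linarith [hb n]⟩
    · exact ⟨fun _ => by linarith [hb n], fun _ => by linarith⟩
  -- The limsup keeps measure at least `δ`, because each tail union contains a set where the norm is
  -- at least `c > t n`.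
  let A₀ : Set X := ⋂ k, ⋃ n ≥ k, B n
  have hA₀m : ∀ k, MeasurableSet (⋃ n ≥ k, B n) := fun k =>
    MeasurableSet.biUnion (Set.to_countable _) fun n _ => hBm n
  have hA₀ : μ A₀ ≠ 0 := by
    have h1 : Tendsto (fun k => μ (⋃ n ≥ k, B n)) atTop (𝓝 (μ A₀)) :=
      tendsto_measure_iInter_atTop (fun k => (hA₀m k).nullMeasurableSet)
        (fun k k' hk => Set.biUnion_subset_biUnion_left fun n hn => le_trans hk hn)
        ⟨0, measure_ne_top _ _⟩
    have h2 : δ ≤ μ A₀ := ge_of_tendsto h1 (Eventually.of_forall fun k =>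
      (hW (φ k)).trans (measure_mono fun x hx => Set.mem_iUnion₂.2
        ⟨k, le_rfl, (ht2 k).trans_le hx⟩))
    exact (pos_iff_ne_zero.2 hδ |>.trans_le h2).ne'
  obtain ⟨A, hAA₀, hAm, hAinv, hAμ⟩ := exists_invariant_subset (μ := μ) hΓ
    (A₀ := A₀) (MeasurableSet.iInter hA₀m) (fun γ => by
      filter_upwards [hBinv γ] with x hx hxA
      obtain ⟨m, hm⟩ := eventually_atTop.1 hx
      refine Set.mem_iInter.2 fun k => ?_
      obtain ⟨n, hn, hxn⟩ := Set.mem_iUnion₂.1 (Set.mem_iInter.1 hxA (max k m))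
      exact Set.mem_iUnion₂.2 ⟨n, (le_max_left _ _).trans hn,
        ((hm n ((le_max_right _ _).trans hn)).2.1 hxn)⟩)
  have hex : ∀ k x, ∃ n, x ∈ A → k ≤ n ∧ x ∈ B n := by
    intro k x
    by_cases hx : x ∈ A
    · obtain ⟨n, hn, hxn⟩ := Set.mem_iUnion₂.1 (Set.mem_iInter.1 (hAA₀ hx) k)
      exact ⟨n, fun _ => ⟨hn, hxn⟩⟩
    · exact ⟨0, fun h => absurd h hx⟩
  -- The first index at least `k` whose superlevel set contains `x`. For large `k` it agrees at `x`
  -- and `γ • x`, so both points use the same field. Off `A` its value is 0 and plays no role.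
  let N : ℕ → X → ℕ := fun k x => Nat.find (hex k x)
  have hN : ∀ k, Measurable (N k) := fun k => measurable_find (hex k) fun n => by
    have : {x | x ∈ A → k ≤ n ∧ x ∈ B n} = Aᶜ ∪ ({_x | k ≤ n} ∩ B n) := by
      ext x
      simp only [Set.mem_ofPred_eq, Set.mem_union, Set.mem_compl_iff, Set.mem_inter_iff]
      tauto
    rw [this]
    exact hAm.compl.union ((MeasurableSet.const _).inter (hBm n))
  have hNspec : ∀ k, ∀ x ∈ A, k ≤ N k x ∧ x ∈ B (N k x) := fun k x hx => Nat.find_spec (hex k x) hx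
  let ξ' : ℕ → ∀ x, H.Fiber x := fun k x => ξ (φ (N k x)) x
  have hξ' : ∀ k, ξ' k ∈ H.measurableSections := fun k =>
    H.piecewise_mem_measurableSections (hN k) hm
  have hcB : ∀ n, ∀ x ∈ B n, c / 2 ≤ ‖ξ (φ n) x‖ := fun n x hx => (ht1 n).trans (le_of_lt hx)
  let ζ : ℕ → ∀ x, H.Fiber x := fun k x =>
    if x ∈ A then ((‖ξ' k x‖⁻¹ : ℝ) : ℂ) • ξ' k x else 0
  have hζ : ∀ k, ζ k ∈ H.measurableSections := fun k =>
    H.indicator_mem_measurableSections hAm (H.smul_mem_measurableSections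
      (Complex.measurable_ofReal.comp (H.measurable_norm _ (hξ' k)).inv) (hξ' k))
  refine ⟨A, hAm, hAinv, hAμ ▸ hA₀, ζ, ?_, ?_, ?_⟩
  · rw [π.isAlmostInvariantSeq_iff hR hΓ]
    refine ⟨hζ, fun k => (1 / 2) ^ k, fun k => by positivity,
      tendsto_pow_atTop_nhds_zero_of_lt_one (by norm_num) (by norm_num), fun γ => ?_⟩
    filter_upwards [hBinv γ] with x hx
    have hxy : R x (γ • x) := (hΓ _ _).2 ⟨γ, rfl⟩
    obtain ⟨m, hm⟩ := eventually_atTop.1 hx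
    filter_upwards [eventually_ge_atTop m] with k hk
    rw [π.defect_eq _ hxy]
    by_cases hxA : x ∈ A
    · have hyA : γ • x ∈ A := (hAinv _ _ hxy).1 hxA
      have hNeq : N k (γ • x) = N k x := by
        refine le_antisymm ?_ ?_
        · refine Nat.find_min' _ fun _ => ⟨(hNspec k x hxA).1, ?_⟩
          exact (hm _ (hk.trans (hNspec k x hxA).1)).2.1 (hNspec k x hxA).2
        · refine Nat.find_min' _ fun _ => ⟨(hNspec k _ hyA).1, ?_⟩
          exact (hm _ (hk.trans (hNspec k _ hyA).1)).2.2 (hNspec k _ hyA).2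
      have hy := hNspec k _ hyA
      have hx' := hNspec k x hxA
      simp only [ζ, ξ', if_pos hxA, if_pos hyA]
      rw [hNeq] at hy ⊢
      rw [map_smul]
      have hn := (hm _ (hk.trans hx'.1)).1
      rw [π.defect_eq _ hxy] at hn
      have h1 := norm_inv_norm_smul_sub_le (half_pos hc)
        (u := π.op x (γ • x) hxy (ξ (φ (N k x)) (γ • x))) (w := ξ (φ (N k x)) x)
        (by rw [(π.op x (γ • x) hxy).norm_map]; exact hcB _ _ hy.2) (hcB _ _ hx'.2)
      rw [(π.op x (γ • x) hxy).norm_map] at h1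
      refine h1.trans ?_
      -- Normalizing above `c / 2` costs a factor `4 / c`, and `4 / c * b k` is half of `(1 / 2) ^
      -- k`.
      have h2 := hn.trans (hbanti hx'.1)
      rw [div_le_iff₀ (half_pos hc)]
      simp only [b] at h2
      have : 0 < c * (1 / 2) ^ k := by positivity
      linarith
    · have hyA : γ • x ∉ A := fun h => hxA ((hAinv _ _ hxy).2 h)
      simp only [ζ, if_neg hxA, if_neg hyA, map_zero, sub_zero, norm_zero]
      positivity
  · intro k x hx
    have h0 : 0 < ‖ξ' k x‖ := (half_pos hc).trans_le (hcB _ _ (hNspec k x hx).2)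
    simp only [ζ, if_pos hx]
    rw [norm_smul, Complex.norm_real, Real.norm_eq_abs, abs_of_pos (inv_pos.2 h0),
      inv_mul_cancel₀ h0.ne']
  · intro k x hx
    simp only [ζ, if_neg hx]

end Action

/-! ### Restricting a representation to an invariant set and adjoining a trivial one. -/

section Glue

variable {X : Type u} [MeasurableSpace X]

namespace HilbertField

variable (H : HilbertField.{u, v} X) (A B : Set X)

/-- The fibre at `x` of the field which restricts `H` to `A` and the constant field `ℂ` to `B`. -/
def glueFiber (x : X) : Submodule ℂ (WithLp 2 (H.Fiber x × EuclideanSpace ℂ PUnit.{v + 1})) where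
  carrier := {u | (x ∉ A → u.fst = 0) ∧ (x ∉ B → u.snd = 0)}
  zero_mem' := ⟨fun _ => rfl, fun _ => rfl⟩
  add_mem' := fun {a b} ha hb =>
    ⟨fun h => by simp [ha.1 h, hb.1 h], fun h => by simp [ha.2 h, hb.2 h]⟩
  smul_mem' := fun c a ha => ⟨fun h => by simp [ha.1 h], fun h => by simp [ha.2 h]⟩

theorem isClosed_glueFiber (x : X) :
    IsClosed (H.glueFiber A B x : Set (WithLp 2 (H.Fiber x × EuclideanSpace ℂ PUnit.{v + 1}))) := by
  have h1 : Continuous fun u : WithLp 2 (H.Fiber x × EuclideanSpace ℂ PUnit.{v + 1}) => u.fst := by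
    fun_prop
  have h2 : Continuous fun u : WithLp 2 (H.Fiber x × EuclideanSpace ℂ PUnit.{v + 1}) => u.snd := by
    fun_prop
  change IsClosed {u : WithLp 2 (H.Fiber x × EuclideanSpace ℂ PUnit.{v + 1}) |
    (x ∉ A → u.fst = 0) ∧ (x ∉ B → u.snd = 0)}
  simp only [Set.ofPred_and, Set.ofPred_forall]
  exact (isClosed_iInter fun _ => isClosed_eq h1 continuous_const).inter
    (isClosed_iInter fun _ => isClosed_eq h2 continuous_const)

variable {H A B} in
/-- The element of a fibre of the glued field with given components. -/
def glueMk {x : X} (a : H.Fiber x) (z : ℂ) (ha : x ∉ A → a = 0) (hz : x ∉ B → z = 0) :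
    H.glueFiber A B x :=
  ⟨WithLp.toLp 2 (a, WithLp.toLp 2 fun _ => z), ha, fun h => by ext; simp [hz h]⟩

-- The scalar summand is a Euclidean space over `PUnit`, which places `ℂ` in the universe of the
-- fibres; its scalar product reduces to a single coordinate.
variable {H A B} in
theorem inner_glueFiber {x : X} (a b : H.glueFiber A B x) :
    inner ℂ a b = inner ℂ a.1.fst b.1.fst +
      b.1.snd PUnit.unit * starRingEnd ℂ (a.1.snd PUnit.unit) := by
  rw [Submodule.coe_inner, WithLp.prod_inner_apply, PiLp.inner_apply]
  simp

variable {H A B} in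
theorem norm_glueFiber {x : X} (a : H.glueFiber A B x) :
    ‖a‖ = √(‖a.1.fst‖ ^ 2 + ‖a.1.snd PUnit.unit‖ ^ 2) := by
  rw [Submodule.coe_norm, WithLp.prod_norm_eq_of_L2, EuclideanSpace.norm_eq,
    Real.sq_sqrt (Finset.sum_nonneg fun _ _ => sq_nonneg _)]
  simp

open Classical in
/-- The field which restricts `H` to `A` and the constant field `ℂ` to `B`. -/
noncomputable def glue (hA : MeasurableSet A) (hB : MeasurableSet B) : HilbertField.{u, v} X where
  Fiber x := H.glueFiber A B x
  complete x := (H.isClosed_glueFiber A B x).completeSpace_coe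
  measurableSections :=
    { carrier := {s | (fun x => (s x).1.fst) ∈ H.measurableSections ∧
        Measurable fun x => (s x).1.snd PUnit.unit}
      zero_mem' := ⟨H.measurableSections.zero_mem, measurable_const⟩
      add_mem' := fun ha hb => ⟨H.measurableSections.add_mem ha.1 hb.1, ha.2.add hb.2⟩
      smul_mem' := fun c s ha => by
        have e : ∀ x, ((c • s) x).1.fst = c • (s x).1.fst := fun x => WithLp.smul_fst _ _
        refine ⟨?_, ha.2.const_smul c⟩
        simp only [e]
        exact H.measurableSections.smul_mem c ha.1 }
  measurable_norm := fun s hs => by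
    simp only [norm_glueFiber]
    exact (((H.measurable_norm _ hs.1).pow_const 2).add (hs.2.norm.pow_const 2)).sqrt
  mem_of_measurable_inner := fun s hs => by
    constructor
    · refine H.mem_of_measurable_inner _ fun ξ hξ => ?_
      have h := hs (fun x => glueMk (if x ∈ A then ξ x else 0) 0 (fun h => if_neg h) fun _ => rfl)
        ⟨H.indicator_mem_measurableSections hA hξ, measurable_const⟩
      convert h using 2 with x
      rw [inner_glueFiber]
      by_cases hx : x ∈ A
      · simp [glueMk, hx]
      · simp [glueMk, hx, (s x).2.1 hx]
    · have h := hs (fun x => glueMk 0 (if x ∈ B then 1 else 0) (fun _ => rfl) fun h => if_neg h)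
        ⟨H.measurableSections.zero_mem, Measurable.ite hB measurable_const measurable_const⟩
      convert h using 2 with x
      rw [inner_glueFiber]
      by_cases hx : x ∈ B
      · simp [glueMk, hx]
      · simp [glueMk, hx, (s x).2.2 hx]
  exists_total := by
    obtain ⟨e, he, htot⟩ := H.exists_total
    refine ⟨fun n => Nat.casesOn n
      (fun x => glueMk 0 (if x ∈ B then 1 else 0) (fun _ => rfl) fun h => if_neg h)
      fun n x => glueMk (if x ∈ A then e n x else 0) 0 (fun h => if_neg h) fun _ => rfl, ?_, ?_⟩
    · rintro (_ | n)
      · exact ⟨H.measurableSections.zero_mem, Measurable.ite hB measurable_const measurable_const⟩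
      · exact ⟨H.indicator_mem_measurableSections hA (he n), measurable_const⟩
    · intro x
      -- Totality is tested on the orthogonal complement: the constant section kills the scalar
      -- component, and the sections `e n` kill the other.
      have := (H.isClosed_glueFiber A B x).completeSpace_coe
      rw [Submodule.topologicalClosure_eq_top_iff, Submodule.eq_bot_iff]
      intro u hu
      rw [Submodule.mem_orthogonal] at hu
      have h0 := hu _ (Submodule.subset_span ⟨0, rfl⟩)
      have hn := fun n => hu _ (Submodule.subset_span ⟨n + 1, rfl⟩)
      simp only [inner_glueFiber] at h0 hn
      have hz : u.1.snd PUnit.unit = 0 := by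
        by_cases hx : x ∈ B
        · simpa [glueMk, hx] using h0
        · rw [u.2.2 hx]; rfl
      have hv : u.1.fst = 0 := by
        by_cases hx : x ∈ A
        · have h1 := (Submodule.topologicalClosure_eq_top_iff).1 (htot x)
          rw [Submodule.eq_bot_iff] at h1
          refine h1 _ ((Submodule.mem_orthogonal _ _).2 fun w hw => ?_)
          induction hw using Submodule.span_induction with
          | mem w hw =>
            obtain ⟨n, rfl⟩ := hw
            simpa [glueMk, hx] using hn n
          | zero => simp
          | add a b _ _ ha hb => rw [inner_add_left, ha, hb, add_zero]
          | smul c a _ ha => rw [inner_smul_left, ha, mul_zero]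
        · exact u.2.1 hx
      rw [← norm_eq_zero, norm_glueFiber, hv, hz]
      simp

end HilbertField

namespace RelRepresentation

variable {R : Setoid X} {H : HilbertField.{u, v} X} (π : RelRepresentation R H) {A B : Set X}

/-- The representation which restricts `π` to `A` and the trivial representation to `B`. -/
noncomputable def glue (hA : MeasurableSet A) (hB : MeasurableSet B)
    (hAR : ∀ x y, R x y → (x ∈ A ↔ y ∈ A)) (hBR : ∀ x y, R x y → (x ∈ B ↔ y ∈ B)) :
    RelRepresentation R (H.glue A B hA hB) where
  op x y h :=
    { toFun := fun u => ⟨WithLp.toLp 2 (π.op x y h u.1.fst, u.1.snd),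
        fun hx => by
          change π.op x y h u.1.fst = 0
          rw [u.2.1 fun hy => hx ((hAR x y h).2 hy), map_zero],
        fun hx => u.2.2 fun hy => hx ((hBR x y h).2 hy)⟩
      invFun := fun u => ⟨WithLp.toLp 2 ((π.op x y h).symm u.1.fst, u.1.snd),
        fun hy => by
          change (π.op x y h).symm u.1.fst = 0
          rw [u.2.1 fun hx => hy ((hAR x y h).1 hx), map_zero],
        fun hy => u.2.2 fun hx => hy ((hBR x y h).1 hx)⟩
      map_add' := fun a b => by
        apply Subtype.ext
        apply WithLp.ofLp_injective
        exact Prod.ext (map_add (π.op x y h) _ _) rfl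
      map_smul' := fun c a => by
        apply Subtype.ext
        apply WithLp.ofLp_injective
        exact Prod.ext (map_smul (π.op x y h) _ _) rfl
      left_inv := fun a => by
        apply Subtype.ext
        apply WithLp.ofLp_injective
        exact Prod.ext ((π.op x y h).symm_apply_apply _) rfl
      right_inv := fun a => by
        apply Subtype.ext
        apply WithLp.ofLp_injective
        exact Prod.ext ((π.op x y h).apply_symm_apply _) rfl
      norm_map' := fun a => by
        refine (HilbertField.norm_glueFiber (A := A) (B := B) _).trans
          (Eq.trans ?_ (HilbertField.norm_glueFiber (A := A) (B := B) _).symm)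
        exact congrArg (fun r => √(r ^ 2 + _)) ((π.op x y h).norm_map _) }
  op_self x h u := by
    apply Subtype.ext
    apply WithLp.ofLp_injective
    exact Prod.ext (π.op_self x h _) rfl
  op_comp x y z hxy hyz hxz u := by
    apply Subtype.ext
    apply WithLp.ofLp_injective
    exact Prod.ext (π.op_comp x y z hxy hyz hxz _) rfl
  measurable_coeff ξ hξ η hη := by
    have h1 := π.measurable_coeff _ hξ.1 _ hη.1
    have h2 : Measurable fun p : {p : X × X // R p.1 p.2} =>
        (η p.1.1).1.snd PUnit.unit * starRingEnd ℂ ((ξ p.1.2).1.snd PUnit.unit) :=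
      (hη.2.comp (measurable_fst.comp measurable_subtype_coe)).mul
        (Complex.continuous_conj.measurable.comp
          (hξ.2.comp (measurable_snd.comp measurable_subtype_coe)))
    convert h1.add h2 using 2 with p
    exact HilbertField.inner_glueFiber _ _

variable {hA : MeasurableSet A} {hB : MeasurableSet B}
  {hAR : ∀ x y, R x y → (x ∈ A ↔ y ∈ A)} {hBR : ∀ x y, R x y → (x ∈ B ↔ y ∈ B)}

theorem defect_glue (s : ∀ x, (H.glue A B hA hB).Fiber x) {x y : X} (h : R x y) :
    (π.glue hA hB hAR hBR).defect s (x, y) =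
      √(π.defect (fun x => (s x).1.fst) (x, y) ^ 2 +
        ‖(s y).1.snd PUnit.unit - (s x).1.snd PUnit.unit‖ ^ 2) := by
  rw [defect_eq _ _ h, defect_eq _ _ h]
  exact HilbertField.norm_glueFiber _

theorem defect_fst_le_defect_glue (s : ∀ x, (H.glue A B hA hB).Fiber x) {x y : X} (h : R x y) :
    π.defect (fun x => (s x).1.fst) (x, y) ≤ (π.glue hA hB hAR hBR).defect s (x, y) := by
  rw [defect_glue _ _ h]
  exact Real.le_sqrt_of_sq_le (le_add_of_nonneg_right (sq_nonneg _))

theorem defect_glue_of_snd_eq (s : ∀ x, (H.glue A B hA hB).Fiber x) {x y : X} (h : R x y)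
    (hs : (s x).1.snd PUnit.unit = (s y).1.snd PUnit.unit) :
    (π.glue hA hB hAR hBR).defect s (x, y) = π.defect (fun x => (s x).1.fst) (x, y) := by
  rw [defect_glue _ _ h, hs, sub_self, norm_zero, zero_pow two_ne_zero, add_zero,
    Real.sqrt_sq (π.defect_nonneg _ _)]

end RelRepresentation

end Glue

/-! ### The weak and strong forms, and the consequence of property T. -/

section Conditions

variable {X : Type u} [MeasurableSpace X] {R : Setoid X} {μ : Measure X}
  {H : HilbertField.{u, v} X}

/-- There is an almost invariant sequence which does not vanish uniformly in measure. -/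
def RelRepresentation.HasNonvanishingSeq (π : RelRepresentation R H) (μ : Measure X) : Prop :=
  ∃ ξ : ℕ → ∀ x, H.Fiber x, π.IsAlmostInvariantSeq μ ξ ∧
    ∃ (c : ℝ) (δ : ℝ≥0∞), 0 < c ∧ δ ≠ 0 ∧ ∀ n, δ ≤ μ {x | c ≤ ‖ξ n x‖}

/-- There is an almost invariant sequence of fields which are unit on `A` and vanish outside. -/
def RelRepresentation.HasUnitSeqOn (π : RelRepresentation R H) (μ : Measure X) (A : Set X) :
    Prop :=
  ∃ ξ : ℕ → ∀ x, H.Fiber x, π.IsAlmostInvariantSeq μ ξ ∧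
    ∀ n, ∀ᵐ x ∂μ, ‖ξ n x‖ = A.indicator (fun _ => (1 : ℝ)) x

variable {π : RelRepresentation R H}

theorem RelRepresentation.LinftyCondition.hasNonvanishingSeq (h : π.LinftyCondition μ) :
    π.HasNonvanishingSeq μ := by
  obtain ⟨ξ, hξ, -, η, δ, hη, hδ, hle⟩ := h
  refine ⟨ξ, hξ, 1 / η, ENNReal.ofReal δ, by positivity, (ENNReal.ofReal_pos.2 hδ).ne', fun n =>
    (hle n).trans (measure_mono fun x hx => hx.1)⟩

/-- Were the set where the norm is at least `1 / 4` too small, absolute continuity of the `p`-norm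
of `g` would bound the norm of `ξⁿ` by `1 / 4 + 1 / 4 < 1`. -/
theorem RelRepresentation.LpCondition.hasNonvanishingSeq [IsProbabilityMeasure μ] {p : ℝ≥0∞}
    (hp : 1 ≤ p) (hp' : p ≠ ∞) (h : π.LpCondition μ p) : π.HasNonvanishingSeq μ := by
  obtain ⟨ξ, hξ, hmem, hnorm, g, hg0, hg, hdom⟩ := h
  obtain ⟨δ, hδ, hδg⟩ := hg.eLpNorm_indicator_le hp hp' (ε := 1 / 4) (by norm_num)
  refine ⟨ξ, hξ, 1 / 4, ENNReal.ofReal δ, by norm_num, (ENNReal.ofReal_pos.2 hδ).ne', fun n => ?_⟩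
  by_contra! hlt
  have hm : MeasurableSet {x | 1 / 4 ≤ ‖ξ n x‖} :=
    measurableSet_le measurable_const (H.measurable_norm _ (hξ.1 n))
  have h1 := hδg _ hm hlt.le
  have hp0 : p ≠ 0 := (zero_lt_one.trans_le hp).ne'
  have h2 : eLpNorm (fun _ : X => (1 / 4 : ℝ)) p μ = ENNReal.ofReal (1 / 4) := by
    rw [eLpNorm_const _ hp0 (IsProbabilityMeasure.ne_zero μ), measure_univ, ENNReal.one_rpow,
      mul_one, ← ofReal_norm, Real.norm_of_nonneg (by norm_num)]
  have h3 : eLpNorm (fun x => ‖ξ n x‖) p μ ≤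
      eLpNorm ((fun _ : X => (1 / 4 : ℝ)) + {x | 1 / 4 ≤ ‖ξ n x‖}.indicator g) p μ := by
    refine eLpNorm_mono_ae_real ?_
    filter_upwards [hdom n] with x hx
    rw [norm_norm, Pi.add_apply]
    by_cases hxs : 1 / 4 ≤ ‖ξ n x‖
    · rw [Set.indicator_of_mem (s := {x | 1 / 4 ≤ ‖ξ n x‖}) hxs]
      linarith
    · rw [Set.indicator_of_notMem (s := {x | 1 / 4 ≤ ‖ξ n x‖}) hxs]
      linarith
  have h4 := h3.trans (eLpNorm_add_le aestronglyMeasurable_const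
    (hg.aestronglyMeasurable.indicator hm) hp)
  rw [hnorm, h2] at h4
  have h5 := h4.trans (add_le_add_right h1 _)
  rw [← ENNReal.ofReal_add (by norm_num) (by norm_num), ← ENNReal.ofReal_one,
    ENNReal.ofReal_le_ofReal_iff (by norm_num)] at h5
  norm_num at h5

theorem RelRepresentation.HasUnitSeqOn.linftyCondition [IsProbabilityMeasure μ] {A : Set X}
    (hμA : μ A ≠ 0) (h : π.HasUnitSeqOn μ A) : π.LinftyCondition μ := by
  obtain ⟨ξ, hξ, hnorm⟩ := h
  refine ⟨ξ, hξ, fun n => ?_, 1, (μ A).toReal, le_rfl,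
    ENNReal.toReal_pos hμA (measure_ne_top _ _), fun n => ?_⟩
  · refine memLp_top_of_bound (H.measurable_norm _ (hξ.1 n)).aestronglyMeasurable 1 ?_
    filter_upwards [hnorm n] with x hx
    rw [norm_norm, hx]
    exact Set.indicator_le_self' (fun _ _ => zero_le_one) x
  · rw [ENNReal.ofReal_toReal (measure_ne_top _ _)]
    refine measure_mono_ae ?_
    filter_upwards [hnorm n] with x hx hxA
    rw [Set.indicator_of_mem hxA] at hx
    change 1 / 1 ≤ ‖ξ n x‖ ∧ ‖ξ n x‖ ≤ 1
    rw [hx]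
    norm_num

theorem RelRepresentation.MooreCondition.hasUnitSeqOn (h : π.MooreCondition μ) :
    π.HasUnitSeqOn μ Set.univ := by
  obtain ⟨ξ, hξ, hnorm⟩ := h
  exact ⟨ξ, hξ, fun n => by simpa using hnorm n⟩

theorem RelRepresentation.defect_smul (c : ℝ) (hc : 0 ≤ c) (ξ : ∀ x, H.Fiber x) (p : X × X) :
    π.defect (fun x => (c : ℂ) • ξ x) p = c * π.defect ξ p := by
  unfold defect
  split_ifs with h
  · rw [map_smul, ← smul_sub, norm_smul, Complex.norm_real, Real.norm_of_nonneg hc]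
  · rw [mul_zero]

variable {Γ : Type*} [Group Γ] [Countable Γ] [MulAction Γ X] [MeasurableConstSMul Γ X]

theorem RelRepresentation.HasUnitSeqOn.lpCondition [IsProbabilityMeasure μ]
    (hR : MeasurableSet (relGraph R)) (hΓ : ∀ x y, R x y ↔ ∃ γ : Γ, y = γ • x)
    {A : Set X} (hA : MeasurableSet A) (hμA : μ A ≠ 0) (h : π.HasUnitSeqOn μ A) {p : ℝ≥0∞}
    (hp : 1 ≤ p) (hp' : p ≠ ∞) : π.LpCondition μ p := by
  obtain ⟨ξ, hξ, hnorm⟩ := h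
  have hp0 : p ≠ 0 := (zero_lt_one.trans_le hp).ne'
  have hr : 0 < (μ A).toReal := ENNReal.toReal_pos hμA (measure_ne_top _ _)
  -- The scaling that gives a unit field on `A` norm 1; the dominating function is then `c` on `A`.
  set c : ℝ := ((μ A).toReal ^ (1 / p.toReal))⁻¹ with hc_def
  have hc : 0 < c := inv_pos.2 (Real.rpow_pos_of_pos hr _)
  rw [π.isAlmostInvariantSeq_iff hR hΓ] at hξ
  obtain ⟨hm, ε, hpos, hlim, hinv⟩ := hξ
  have hcm : ∀ n, (fun x => (c : ℂ) • ξ n x) ∈ H.measurableSections := fun n =>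
    H.smul_mem_measurableSections measurable_const (hm n)
  have hae : ∀ n, (fun x => ‖(c : ℂ) • ξ n x‖) =ᵐ[μ] A.indicator fun _ => c := fun n => by
    filter_upwards [hnorm n] with x hx
    rw [norm_smul, Complex.norm_real, Real.norm_of_nonneg hc.le, hx]
    by_cases hxA : x ∈ A <;> simp [hxA]
  have hLp : MemLp (A.indicator fun _ => c) p μ := memLp_indicator_const p hA c
    (Or.inr (measure_ne_top _ _))
  refine ⟨fun n x => (c : ℂ) • ξ n x, ?_, fun n => hLp.ae_eq (hae n).symm, fun n => ?_,
    A.indicator fun _ => c, fun x => Set.indicator_nonneg (fun _ _ => hc.le) x, hLp,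
    fun n => (hae n).le⟩
  · rw [π.isAlmostInvariantSeq_iff hR hΓ]
    refine ⟨hcm, fun n => c * ε n, fun n => mul_pos hc (hpos n), by simpa using hlim.const_mul c,
      fun γ => ?_⟩
    filter_upwards [hinv γ] with x hx
    filter_upwards [hx] with n hn
    rw [π.defect_smul c hc.le]
    exact mul_le_mul_of_nonneg_left hn hc.le
  · rw [eLpNorm_congr_ae (hae n), eLpNorm_indicator_const hA hp0 hp', ← ofReal_norm,
      Real.norm_of_nonneg hc.le]
    rw [← ENNReal.ofReal_toReal (measure_ne_top μ A)]
    rw [ENNReal.ofReal_rpow_of_pos hr, ← ENNReal.ofReal_mul hc.le, hc_def,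
      inv_mul_cancel₀ (Real.rpow_pos_of_pos hr _).ne', ENNReal.ofReal_one]

/-- Ergodicity forces the invariant set of the key lemma to be conull. -/
theorem RelRepresentation.HasNonvanishingSeq.mooreCondition [IsProbabilityMeasure μ]
    (hR : MeasurableSet (relGraph R)) (hΓ : ∀ x y, R x y ↔ ∃ γ : Γ, y = γ • x)
    (herg : IsErgodicRel R μ) (h : π.HasNonvanishingSeq μ) : π.MooreCondition μ := by
  obtain ⟨ξ, hξ, c, δ, hc, hδ, hW⟩ := h
  obtain ⟨A, hA, hAR, hμA, ζ, hζ, hone, -⟩ := hξ.exists_unit_on_invariant hR hΓ hc hδ hW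
  refine ⟨ζ, hζ, fun n => ?_⟩
  have hA' : ∀ᵐ x ∂μ, x ∈ A := (herg A hA hAR).resolve_left hμA
  filter_upwards [hA'] with x hx
  exact hone n x hx

/-- Under property T, almost invariant sequences which do not vanish in measure give non-trivial
invariant fields. -/
theorem HasPropertyT.hasNontrivialInvariantField [IsProbabilityMeasure μ]
    (hR : MeasurableSet (relGraph R)) (hΓ : ∀ x y, R x y ↔ ∃ γ : Γ, y = γ • x)
    (hT : HasPropertyT.{u, v} R μ) (h : π.HasNonvanishingSeq μ) :
    π.HasNontrivialInvariantField μ := by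
  classical
  obtain ⟨ξ, hξ, c, δ, hc, hδ, hW⟩ := h
  obtain ⟨A, hA, hAR, hμA, ζ, hζ, hone, hzero⟩ := hξ.exists_unit_on_invariant hR hΓ hc hδ hW
  have hBR : ∀ x y, R x y → (x ∈ Aᶜ ↔ y ∈ Aᶜ) := fun x y h => not_congr (hAR x y h)
  rw [π.isAlmostInvariantSeq_iff hR hΓ] at hζ
  obtain ⟨hm, ε, hpos, hlim, hinv⟩ := hζ
  -- The constant 1 on the complement completes the sequence to unit fields, so property T applies
  -- even when `A` is not conull.
  let s : ℕ → ∀ x, (H.glue A Aᶜ hA hA.compl).Fiber x := fun n x =>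
    HilbertField.glueMk (ζ n x) (if x ∈ A then 0 else 1) (hzero n x)
      fun hx => if_pos (not_not.1 hx)
  have hs : ∀ n, s n ∈ (H.glue A Aᶜ hA hA.compl).measurableSections := fun n =>
    ⟨hm n, Measurable.ite hA measurable_const measurable_const⟩
  have hR' : ∀ (x : X) (γ : Γ), R x (γ • x) := fun x γ => (hΓ _ _).2 ⟨γ, rfl⟩
  have hMoore : (π.glue hA hA.compl hAR hBR).MooreCondition μ := by
    refine ⟨s, ?_, fun n => Eventually.of_forall fun x => ?_⟩
    · rw [RelRepresentation.isAlmostInvariantSeq_iff _ hR hΓ]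
      refine ⟨hs, ε, hpos, hlim, fun γ => ?_⟩
      filter_upwards [hinv γ] with x hx
      filter_upwards [hx] with n hn
      rw [π.defect_glue_of_snd_eq (s n) (hR' x γ)]
      · exact hn
      · change (if x ∈ A then (0 : ℂ) else 1) = if γ • x ∈ A then 0 else 1
        simp only [hAR _ _ (hR' x γ)]
    · refine (HilbertField.norm_glueFiber _).trans ?_
      change √(‖ζ n x‖ ^ 2 + ‖if x ∈ A then (0 : ℂ) else 1‖ ^ 2) = 1
      by_cases hx : x ∈ A
      · simp [hx, hone n x hx]
      · simp [hx, hzero n x hx]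
  obtain ⟨t, ht, htone⟩ := hT _ _ hMoore
  rw [RelRepresentation.isInvariantField_iff _ hR hΓ] at ht
  refine ⟨fun x => (t x).1.fst, ?_, ?_⟩
  · rw [π.isInvariantField_iff hR hΓ]
    refine ⟨ht.1.1, fun γ => ?_⟩
    filter_upwards [ht.2 γ] with x hx
    exact le_antisymm ((π.defect_fst_le_defect_glue t (hR' x γ)).trans hx.le)
      (π.defect_nonneg _ _)
  -- On `A` the scalar component vanishes, so the first one carries the whole unit norm.
  · refine fun h0 => hμA (measure_mono_null_ae ?_ h0)
    filter_upwards [htone] with x hx hxA hx0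
    have h1 := (HilbertField.norm_glueFiber (t x)).symm.trans hx
    rw [not_not.1 (fun h => h hx0), (t x).2.2 (fun h => h hxA)] at h1
    simp at h1

end Conditions

/-! ### Exhaustion and the converse for property T. -/

/-- Exhaustion: a class of sets which is closed under countable unions has a member of maximal
measure. -/
theorem MeasureTheory.exists_measure_maximal {X : Type*} [MeasurableSpace X] (μ : Measure X)
    {P : Set X → Prop} (h0 : P ∅) (hP : ∀ A : ℕ → Set X, (∀ n, P (A n)) → P (⋃ n, A n)) :
    ∃ A, P A ∧ ∀ B, P B → μ B ≤ μ A := by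
  obtain ⟨m, -, hm, hmem⟩ := exists_seq_tendsto_sSup
    (show (μ '' {A | P A}).Nonempty from ⟨μ ∅, ∅, h0, rfl⟩) (OrderTop.bddAbove _)
  choose A hA hAm using hmem
  refine ⟨⋃ n, A n, hP A hA, fun B hB => ?_⟩
  refine (le_sSup (s := μ '' {A | P A}) ⟨B, hB, rfl⟩).trans (le_of_tendsto' hm fun n => ?_)
  rw [← hAm n]
  exact measure_mono (Set.subset_iUnion A n)

section Converse

variable {X : Type u} [MeasurableSpace X] {R : Setoid X} {μ : Measure X}
  {H : HilbertField.{u, v} X} {π : RelRepresentation R H}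

/-- There is a field which is unit on the invariant Borel set `A` and strictly invariant there. -/
def RelRepresentation.HasUnitInvariantFieldOn (π : RelRepresentation R H) (A : Set X) : Prop :=
  MeasurableSet A ∧ (∀ x y, R x y → (x ∈ A ↔ y ∈ A)) ∧
    ∃ ξ ∈ H.measurableSections, (∀ x ∈ A, ‖ξ x‖ = 1) ∧
      ∀ x ∈ A, ∀ y, R x y → π.defect ξ (x, y) = 0

/-- The first index whose set contains the point is constant along classes, since the sets are
invariant; selecting the field by it preserves invariance. -/
theorem RelRepresentation.HasUnitInvariantFieldOn.iUnion {A : ℕ → Set X}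
    (h : ∀ n, π.HasUnitInvariantFieldOn (A n)) : π.HasUnitInvariantFieldOn (⋃ n, A n) := by
  classical
  choose hA hAR ξ hξ hone hinv using h
  have hUR : ∀ x y, R x y → (x ∈ ⋃ n, A n ↔ y ∈ ⋃ n, A n) := fun x y hxy => by
    simp only [Set.mem_iUnion, hAR _ x y hxy]
  have hU : MeasurableSet (⋃ n, A n) := MeasurableSet.iUnion hA
  have hex : ∀ x, ∃ n, x ∈ ⋃ n, A n → x ∈ A n := fun x => by
    by_cases hx : x ∈ ⋃ n, A n
    · obtain ⟨n, hn⟩ := Set.mem_iUnion.1 hx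
      exact ⟨n, fun _ => hn⟩
    · exact ⟨0, fun h => absurd h hx⟩
  let N : X → ℕ := fun x => Nat.find (hex x)
  have hN : Measurable N := measurable_find hex fun n => by
    have : {x | x ∈ ⋃ n, A n → x ∈ A n} = (⋃ n, A n)ᶜ ∪ A n := by
      ext x
      simp only [Set.mem_ofPred_eq, Set.mem_union, Set.mem_compl_iff]
      tauto
    rw [this]
    exact hU.compl.union (hA n)
  have hNA : ∀ x ∈ ⋃ n, A n, x ∈ A (N x) := fun x hx => Nat.find_spec (hex x) hx
  have hNR : ∀ x y, R x y → N x = N y := fun x y hxy =>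
    Nat.find_congr' fun {n} => by rw [hUR x y hxy, hAR n x y hxy]
  refine ⟨hU, hUR, fun x => ξ (N x) x, H.piecewise_mem_measurableSections hN hξ,
    fun x hx => hone _ x (hNA x hx), fun x hx y hxy => ?_⟩
  have h1 := hinv _ x (hNA x hx) y hxy
  rw [π.defect_eq _ hxy] at h1 ⊢
  rwa [← hNR x y hxy]

variable {Γ : Type*} [Group Γ] [Countable Γ] [MulAction Γ X] [MeasurableConstSMul Γ X]

/-- A non-trivial invariant field can be normalized on an invariant set of positive measure. -/
theorem RelRepresentation.IsInvariantField.exists_hasUnitInvariantFieldOn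
    (hR : IsMeasuredEquivRel R μ) (hΓ : ∀ x y, R x y ↔ ∃ γ : Γ, y = γ • x)
    {ξ : ∀ x, H.Fiber x} (hξ : π.IsInvariantField μ ξ) (h0 : μ {x | ξ x ≠ 0} ≠ 0) :
    ∃ A ⊆ {x | ξ x ≠ 0}, μ A ≠ 0 ∧ π.HasUnitInvariantFieldOn A := by
  rw [π.isInvariantField_iff hR.measurableSet_graph hΓ] at hξ
  obtain ⟨hm, hinv⟩ := hξ
  have hdm := π.measurable_defect hR.measurableSet_graph hm
  have hR' : ∀ (x : X) (γ : Γ), R x (γ • x) := fun x γ => (hΓ _ _).2 ⟨γ, rfl⟩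
  -- Keeping only points with exact invariance along their whole orbit upgrades the almost
  -- everywhere statement to a strict one; quasi-invariance shows that this set is almost everywhere
  -- invariant.
  set A₀ : Set X := {x | ξ x ≠ 0} ∩ {x | ∀ γ : Γ, π.defect ξ (x, γ • x) = 0} with hA₀_def
  have hA₀ : MeasurableSet A₀ := by
    refine MeasurableSet.inter ?_ ?_
    · have : {x | ξ x ≠ 0} = {x | ‖ξ x‖ = 0}ᶜ := by ext x; simp
      rw [this]
      exact (measurableSet_eq_fun (H.measurable_norm _ hm) measurable_const).compl
    · simp only [Set.ofPred_forall]
      exact MeasurableSet.iInter fun γ => measurableSet_eq_fun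
        (hdm.comp (measurable_id.prodMk (measurable_const_smul γ))) measurable_const
  have hall := ae_all_iff.2 hinv
  obtain ⟨A, hAA₀, hA, hAR, hμA⟩ := exists_invariant_subset (μ := μ) hΓ hA₀ fun γ => by
    filter_upwards [hR.ae_smul hΓ γ hall] with x hx hxA
    refine ⟨fun h => hxA.1 ?_, hx⟩
    have h1 := π.abs_norm_sub_norm_le_defect ξ (hR' x γ)
    rw [hxA.2 γ, h, norm_zero, zero_sub, abs_neg, abs_norm] at h1
    exact norm_le_zero_iff.1 h1
  have hAne : ∀ x ∈ A, ‖ξ x‖ ≠ 0 := fun x hx => norm_ne_zero_iff.2 (hAA₀ hx).1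
  refine ⟨A, fun x hx => (hAA₀ hx).1, ?_, hA, hAR, fun x => ((‖ξ x‖⁻¹ : ℝ) : ℂ) • ξ x,
    H.smul_mem_measurableSections
      (Complex.measurable_ofReal.comp (H.measurable_norm _ hm).inv) hm, fun x hx => ?_,
    fun x hx y hxy => ?_⟩
  · rw [hμA]
    refine fun h => h0 (measure_mono_null_ae ?_ h)
    filter_upwards [hall] with x hx hx0
    exact ⟨hx0, hx⟩
  · rw [norm_smul, Complex.norm_real, norm_inv, norm_norm, inv_mul_cancel₀ (hAne x hx)]
  · obtain ⟨γ, rfl⟩ := (hΓ x y).1 hxy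
    have h1 := (hAA₀ hx).2 γ
    have h2 := π.abs_norm_sub_norm_le_defect ξ hxy
    rw [h1] at h2
    have h3 : ‖ξ (γ • x)‖ = ‖ξ x‖ := sub_eq_zero.1 (abs_nonpos_iff.1 h2)
    rw [π.defect_eq _ hxy] at h1 ⊢
    rw [h3, map_smul, ← smul_sub, norm_smul, h1, mul_zero]

/-- If unit sequences on sets of positive measure always give non-trivial invariant fields, then
the relation has property T. -/
theorem hasPropertyT_of_forall_hasUnitSeqOn [IsProbabilityMeasure μ]
    (hR : IsMeasuredEquivRel R μ) (hΓ : ∀ x y, R x y ↔ ∃ γ : Γ, y = γ • x)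
    (h : ∀ (H : HilbertField.{u, v} X) (π : RelRepresentation R H) (A : Set X), MeasurableSet A →
      μ A ≠ 0 → π.HasUnitSeqOn μ A → π.HasNontrivialInvariantField μ) :
    HasPropertyT.{u, v} R μ := by
  classical
  intro H π ⟨ξ, hξ, hone⟩
  have hRm := hR.measurableSet_graph
  have hR' : ∀ (x : X) (γ : Γ), R x (γ • x) := fun x γ => (hΓ _ _).2 ⟨γ, rfl⟩
  obtain ⟨A, hA, hmax⟩ := exists_measure_maximal μ (P := π.HasUnitInvariantFieldOn)
    ⟨MeasurableSet.empty, fun _ _ _ => Iff.rfl, 0, H.measurableSections.zero_mem,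
      fun _ hx => absurd hx (Set.notMem_empty _), fun _ hx => absurd hx (Set.notMem_empty _)⟩
    fun A hA => RelRepresentation.HasUnitInvariantFieldOn.iUnion hA
  have hAm := hA.1
  have hAR : ∀ x y, R x y → (x ∈ Aᶜ ↔ y ∈ Aᶜ) := fun x y h => not_congr (hA.2.1 x y h)
  have hnull : μ Aᶜ = 0 := by
    by_contra hμ
    rw [π.isAlmostInvariantSeq_iff hRm hΓ] at hξ
    obtain ⟨hm, ε, hpos, hlim, hinv⟩ := hξ
    let s : ℕ → ∀ x, (H.glue Aᶜ ∅ hAm.compl MeasurableSet.empty).Fiber x := fun n x =>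
      HilbertField.glueMk (if x ∈ Aᶜ then ξ n x else 0) 0 (fun hx => if_neg hx) fun _ => rfl
    -- Restricting to the complement of `A` forces the new invariant field to live there; for `π`
    -- itself it could be supported in `A`. Normalized, it enlarges `A` and contradicts maximality.
    let π' := π.glue hAm.compl MeasurableSet.empty hAR fun _ _ _ => Iff.rfl
    obtain ⟨t, ht, ht0⟩ := h _ π' Aᶜ hAm.compl hμ ⟨s, by
        rw [RelRepresentation.isAlmostInvariantSeq_iff _ hRm hΓ]
        refine ⟨fun n => ⟨H.indicator_mem_measurableSections hAm.compl (hm n),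
          measurable_const⟩, ε, hpos, hlim, fun γ => ?_⟩
        filter_upwards [hinv γ] with x hx
        filter_upwards [hx] with n hn
        rw [π.defect_glue_of_snd_eq (s n) (hR' x γ) rfl]
        rw [π.defect_eq _ (hR' x γ)] at hn ⊢
        change ‖π.op _ _ _ (if γ • x ∈ Aᶜ then ξ n (γ • x) else 0) -
          (if x ∈ Aᶜ then ξ n x else 0)‖ ≤ _
        by_cases hxA : x ∈ Aᶜ
        · rwa [if_pos hxA, if_pos ((hAR _ _ (hR' x γ)).1 hxA)]
        · rw [if_neg hxA, if_neg fun h => hxA ((hAR _ _ (hR' x γ)).2 h), map_zero, sub_zero,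
            norm_zero]
          exact (hpos n).le, fun n => by
        filter_upwards [hone n] with x hx
        refine (HilbertField.norm_glueFiber _).trans ?_
        change √(‖if x ∈ Aᶜ then ξ n x else 0‖ ^ 2 + ‖(0 : ℂ)‖ ^ 2) = _
        by_cases hxA : x ∈ Aᶜ
        · rw [if_pos hxA, hx, Set.indicator_of_mem hxA]
          simp
        · rw [if_neg hxA, Set.indicator_of_notMem hxA]
          simp⟩
    rw [RelRepresentation.isInvariantField_iff _ hRm hΓ] at ht
    have hsnd : ∀ x, (t x).1.snd = 0 := fun x => (t x).2.2 (Set.notMem_empty x)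
    have hfst : π.IsInvariantField μ fun x => (t x).1.fst := by
      rw [π.isInvariantField_iff hRm hΓ]
      refine ⟨ht.1.1, fun γ => ?_⟩
      filter_upwards [ht.2 γ] with x hx
      exact le_antisymm ((π.defect_fst_le_defect_glue t (hR' x γ)).trans hx.le)
        (π.defect_nonneg _ _)
    obtain ⟨A', hA', hμA', hunit⟩ := hfst.exists_hasUnitInvariantFieldOn hR hΓ fun h0 => by
      refine ht0 (measure_mono_null (t := {x | (t x).1.fst ≠ 0}) (fun x hx hx0 => hx ?_) h0)
      apply norm_eq_zero.1
      refine (HilbertField.norm_glueFiber (t x)).trans ?_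
      rw [hx0, hsnd]
      simp
    have hdisj : Disjoint A A' := Set.disjoint_left.2 fun x hx hx' =>
      hA' hx' ((t x).2.1 (not_not.2 hx))
    have hunion : π.HasUnitInvariantFieldOn (A ∪ A') := by
      have := RelRepresentation.HasUnitInvariantFieldOn.iUnion (π := π)
        (A := fun n => if n = 0 then A else A') fun n => by split_ifs <;> assumption
      convert this using 1
      ext x
      simp only [Set.mem_union, Set.mem_iUnion]
      constructor
      · rintro (h | h)
        · exact ⟨0, by simpa using h⟩
        · exact ⟨1, by simpa using h⟩
      · rintro ⟨n, hn⟩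
        split_ifs at hn
        · exact Or.inl hn
        · exact Or.inr hn
    have hle := hmax _ hunion
    rw [measure_union hdisj hunit.1] at hle
    exact hμA' (le_zero_iff.1 (ENNReal.le_of_add_le_add_left (measure_ne_top μ A)
      (hle.trans_eq (add_zero _).symm)))
  obtain ⟨-, -, ζ, hζ, hζone, hζinv⟩ := hA
  have hae : ∀ᵐ x ∂μ, x ∈ A := hnull
  refine ⟨ζ, (π.isInvariantField_iff hRm hΓ).2 ⟨hζ, fun γ => ?_⟩, ?_⟩
  · filter_upwards [hae] with x hx
    exact hζinv x hx _ (hR' x γ)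
  · filter_upwards [hae] with x hx
    exact hζone x hx

/-! ### Zimmer's condition and the main theorem. -/

/-- For vectors of norm at most 1, a scalar product within `ε` of 1 bounds the squared defect by `2
* ε`. Summable errors and Borel-Cantelli turn smallness in measure into eventual estimates. -/
theorem RelRepresentation.HasNonvanishingSeq.of_zimmer {Γ : Type} [Group Γ] [Countable Γ]
    [MulAction Γ X] [MeasurableConstSMul Γ X] [IsProbabilityMeasure μ]
    (hR : IsMeasuredEquivRel R μ) (hΓ : ∀ x y, R x y ↔ ∃ γ : Γ, y = γ • x)
    (h : π.ZimmerCondition μ) : π.HasNonvanishingSeq μ := by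
  classical
  have hR' : ∀ (x : X) (γ : Γ), R x (γ • x) := fun x γ => (hΓ _ _).2 ⟨γ, rfl⟩
  obtain ⟨e, he⟩ := exists_surjective_nat Γ
  -- The identity is included because its coefficient is the squared norm, which bounds the norm
  -- below by `1 / 2` off a small set.
  let F : ℕ → Finset Γ := fun n => insert 1 ((Finset.range n).image e)
  -- Chosen so that `2 * ε n` is the square of the invariance error `(1 / 2) ^ (n + 1)`.
  let ε : ℕ → ℝ := fun n => 1 / 2 * (1 / 4) ^ (n + 1)
  have hε : ∀ n, 0 < ε n := fun n => by positivity
  choose ξ hm hnorm hbad using fun n => h Γ hΓ (ε n) (hε n) (F n)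
  have hle : ∀ n, ∀ᵐ x ∂μ, ‖ξ n x‖ ≤ 1 := fun n => by
    have h1 := hnorm n
    rw [eLpNorm_exponent_top] at h1
    filter_upwards [enorm_ae_le_eLpNormEssSup (fun x => ‖ξ n x‖) μ] with x hx
    rw [h1, ← ofReal_norm, norm_norm, ENNReal.ofReal_le_one] at hx
    exact hx
  have hgood : ∀ n x (γ : Γ), ‖inner ℂ (π.op x (γ • x) (hR' x γ) (ξ n (γ • x))) (ξ n x) - 1‖ < ε n →
      1 - ε n ≤ (inner ℂ (π.op x (γ • x) (hR' x γ) (ξ n (γ • x))) (ξ n x)).re := by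
    intro n x γ hlt
    have h1 := (Complex.abs_re_le_norm _).trans hlt.le
    rw [Complex.sub_re, Complex.one_re, abs_le] at h1
    linarith [h1.1]
  refine ⟨ξ, ?_, 1 / 2, 1 - ENNReal.ofReal (1 / 8), by norm_num, ?_, fun n => ?_⟩
  · rw [π.isAlmostInvariantSeq_iff hR.measurableSet_graph hΓ]
    refine ⟨hm, fun n => (1 / 2) ^ (n + 1), fun n => by positivity,
      (tendsto_add_atTop_iff_nat 1).2
        (tendsto_pow_atTop_nhds_zero_of_lt_one (by norm_num) (by norm_num)), fun γ => ?_⟩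
    obtain ⟨k, rfl⟩ := he γ
    have hsum : ∑' n, μ (if e k ∈ F n then {x | ∃ h : R x (e k • x),
        ε n ≤ ‖inner ℂ (π.op x (e k • x) h (ξ n (e k • x))) (ξ n x) - 1‖} else ∅) ≠ ∞ := by
      refine ne_top_of_le_ne_top (b := ∑' n, ENNReal.ofReal (ε n)) ?_
        (ENNReal.tsum_le_tsum fun n => ?_)
      · refine Summable.tsum_ofReal_ne_top ?_
        exact ((summable_nat_add_iff 1).2
          (summable_geometric_of_lt_one (by norm_num) (by norm_num))).mul_left _
      · split_ifs with hk
        · exact hbad n _ hk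
        · simp
    filter_upwards [ae_eventually_notMem hsum, ae_all_iff.2 hle,
      hR.ae_smul hΓ (e k) (ae_all_iff.2 hle)] with x hx h1 h2
    filter_upwards [hx, eventually_gt_atTop k] with n hn hkn
    have hk : e k ∈ F n := Finset.mem_insert_of_mem
      (Finset.mem_image_of_mem e (Finset.mem_range.2 hkn))
    rw [if_pos hk] at hn
    have h3 := hgood n x (e k) (not_le.1 fun hcon => hn ⟨hR' x (e k), hcon⟩)
    have h4 := π.norm_sq_defect (ξ n) (hR' x (e k))
    have h5 : ‖ξ n (e k • x)‖ ^ 2 ≤ 1 := pow_le_one₀ (norm_nonneg _) (h2 n)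
    have h6 : ‖ξ n x‖ ^ 2 ≤ 1 := pow_le_one₀ (norm_nonneg _) (h1 n)
    have h7 : ((1 / 2 : ℝ) ^ (n + 1)) ^ 2 = 2 * ε n := by
      simp only [ε]
      rw [← pow_mul, mul_comm, pow_mul, ← mul_assoc]
      norm_num
    refine (abs_le_of_sq_le_sq' ?_ (by positivity)).2
    rw [h7, h4]
    linarith
  · refine (tsub_pos_of_lt ?_).ne'
    rw [← ENNReal.ofReal_one, ENNReal.ofReal_lt_ofReal_iff one_pos]
    norm_num
  · rw [tsub_le_iff_right]
    have hε8 : ε n ≤ 1 / 8 := by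
      have : ((1 : ℝ) / 4) ^ n ≤ 1 := pow_le_one₀ (by norm_num) (by norm_num)
      simp only [ε, pow_succ]
      linarith
    calc (1 : ℝ≥0∞) = μ Set.univ := measure_univ.symm
      _ ≤ μ ({x | 1 / 2 ≤ ‖ξ n x‖} ∪ {x | ∃ h : R x ((1 : Γ) • x),
          ε n ≤ ‖inner ℂ (π.op x ((1 : Γ) • x) h (ξ n ((1 : Γ) • x))) (ξ n x) - 1‖}) := by
        refine measure_mono fun x _ => ?_
        by_contra hcon
        rw [Set.mem_union, not_or] at hcon
        have h1 : ‖ξ n x‖ < 1 / 2 := not_le.1 hcon.1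
        have h2 := hgood n x 1 (not_le.1 fun h => hcon.2 ⟨hR' x 1, h⟩)
        have h3 := (Complex.re_le_norm _).trans (norm_inner_le_norm (𝕜 := ℂ)
          (π.op x ((1 : Γ) • x) (hR' x 1) (ξ n ((1 : Γ) • x))) (ξ n x))
        have h4 : ‖ξ n ((1 : Γ) • x)‖ = ‖ξ n x‖ := by rw [one_smul]
        rw [(π.op _ _ _).norm_map, h4] at h3
        nlinarith [norm_nonneg (ξ n x)]
      _ ≤ _ := measure_union_le _ _
      _ ≤ _ := add_le_add_right ((hbad n 1 (Finset.mem_insert_self _ _)).trans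
        (ENNReal.ofReal_le_ofReal hε8)) _

/-- Moore's condition implies Zimmer's condition. -/
theorem RelRepresentation.MooreCondition.zimmerCondition [IsProbabilityMeasure μ]
    (hR : MeasurableSet (relGraph R)) (h : π.MooreCondition μ) : π.ZimmerCondition μ := by
  intro Γ _ _ _ _ hΓ ε hε F
  have hR' : ∀ (x : X) (γ : Γ), R x (γ • x) := fun x γ => (hΓ _ _).2 ⟨γ, rfl⟩
  obtain ⟨ξ, hξ, hone⟩ := h
  rw [π.isAlmostInvariantSeq_iff hR hΓ] at hξ
  obtain ⟨hm, b, hpos, hlim, hinv⟩ := hξ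
  have hsmall : ∀ γ : Γ, ∀ᶠ n in atTop,
      μ {x | ε ≤ π.defect (ξ n) (x, γ • x)} ≤ ENNReal.ofReal ε := by
    intro γ
    have hmeas : ∀ n, MeasurableSet {x | ε ≤ π.defect (ξ n) (x, γ • x)} := fun n =>
      measurableSet_le measurable_const ((π.measurable_defect hR (hm n)).comp
        (measurable_id.prodMk (measurable_const_smul γ)))
    have h0 : Tendsto (fun n => μ {x | ε ≤ π.defect (ξ n) (x, γ • x)}) atTop (𝓝 (μ ∅)) := by
      refine tendsto_measure_of_ae_tendsto_indicator_of_isFiniteMeasure atTop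
        MeasurableSet.empty hmeas ?_
      filter_upwards [hinv γ] with x hx
      filter_upwards [hx, hlim.eventually (gt_mem_nhds hε)] with n hn hn'
      simp only [Set.mem_empty_iff_false, iff_false, not_le]
      exact hn.trans_lt hn'
    rw [measure_empty] at h0
    exact h0.eventually_le_const (ENNReal.ofReal_pos.2 hε)
  obtain ⟨n, hn⟩ := ((eventually_all_finset F).2 fun γ _ => hsmall γ).exists
  refine ⟨ξ n, hm n, ?_, fun γ hγ => (measure_mono_ae ?_).trans (hn γ hγ)⟩
  · rw [eLpNorm_congr_ae (hone n), eLpNorm_const _ (by simp) (IsProbabilityMeasure.ne_zero μ)]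
    simp
  · filter_upwards [hone n] with x hx
    rintro ⟨h, hle⟩
    refine hle.trans ?_
    -- Writing 1 as the squared norm turns the deviation into the scalar product of the displacement
    -- with a unit vector.
    have h1 : (1 : ℂ) = inner ℂ (ξ n x) (ξ n x) := by
      rw [inner_self_eq_norm_sq_to_K, hx]
      simp
    rw [h1, ← inner_sub_left, π.defect_eq _ h]
    refine (norm_inner_le_norm _ _).trans ?_
    rw [hx, mul_one]

end Converse

theorem mainTheorem6 {X : Type u} [MeasurableSpace X] [StandardBorelSpace X]
    (μ : Measure X) [IsProbabilityMeasure μ] [NullSingletonClass μ]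
    (R : Setoid X) (hR : IsMeasuredEquivRel R μ) :
    (HasPropertyT.{u, v} R μ ↔
      ∀ (H : HilbertField.{u, v} X) (π : RelRepresentation R H),
        π.LinftyCondition μ → π.HasNontrivialInvariantField μ) ∧
    (∀ p : ℝ≥0∞, 1 ≤ p → p ≠ ∞ →
      (HasPropertyT.{u, v} R μ ↔
        ∀ (H : HilbertField.{u, v} X) (π : RelRepresentation R H),
          π.LpCondition μ p → π.HasNontrivialInvariantField μ)) ∧
    (IsErgodicRel R μ →
      ∀ (H : HilbertField.{u, v} X) (π : RelRepresentation R H),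
        ∀ p : ℝ≥0∞, 1 ≤ p → p ≠ ∞ →
          List.TFAE [π.ZimmerCondition μ, π.MooreCondition μ,
            π.LinftyCondition μ, π.LpCondition μ p]) := by
  have hRm := hR.measurableSet_graph
  -- The group obtained is `FreeGroup ℕ`, which lies in `Type`, so Zimmer's condition applies to
  -- this very action.
  obtain ⟨_, _, hΓ⟩ := exists_mulAction_orbitRel_eq hRm hR.countable_class
  refine ⟨⟨fun hT H π h => hT.hasNontrivialInvariantField hRm hΓ h.hasNonvanishingSeq,
    fun h => hasPropertyT_of_forall_hasUnitSeqOn hR hΓ fun H π A _ hμA hA =>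
      h H π (hA.linftyCondition hμA)⟩,
    fun p hp hp' => ⟨fun hT H π h => hT.hasNontrivialInvariantField hRm hΓ
      (h.hasNonvanishingSeq hp hp'),
    fun h => hasPropertyT_of_forall_hasUnitSeqOn hR hΓ fun H π A hAm hμA hA =>
      h H π (hA.lpCondition hRm hΓ hAm hμA hp hp')⟩,
    fun herg H π p hp hp' => ?_⟩
  have hμ : μ Set.univ ≠ 0 := by simp
  tfae_have 2 → 1 := fun h => h.zimmerCondition hRm
  tfae_have 1 → 2 := fun h =>
    (RelRepresentation.HasNonvanishingSeq.of_zimmer hR hΓ h).mooreCondition hRm hΓ herg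
  tfae_have 2 → 3 := fun h => h.hasUnitSeqOn.linftyCondition hμ
  tfae_have 3 → 2 := fun h => h.hasNonvanishingSeq.mooreCondition hRm hΓ herg
  tfae_have 2 → 4 := fun h => h.hasUnitSeqOn.lpCondition hRm hΓ MeasurableSet.univ hμ hp hp'
  tfae_have 4 → 2 := fun h => (h.hasNonvanishingSeq hp hp').mooreCondition hRm hΓ herg
  tfae_finish
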